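/- **Setting.** A *constraint* is a finite conjunction of comparisons ($=,\neq,<,\le,\ge,>$) of linear polynomials with integer coefficients (or `true`, or `false`). A *CLP program* is a finite set of clauses $A \texttt{ :- } c, B$, with $A$ an atom, $c$ a constraint, $B$ a conjunction of atoms; $M(P)$ is its least model over the ground terms built from the integers and the function symbols, constraints having their standard meaning on the integers. Write $c\sqsubseteq d$ for $\forall(c\to d)$. Conjunctions are taken up to the order of their members where subconjunctions are selected for replacement or folding. Let $P$ be a CLP program in which the $0$-ary predicate $\mathtt{incorrect}$ is defined by the single clause $C_0=(\mathtt{incorrect}\texttt{ :- }c,G)$. Let the predicate symbols be partitioned into *high* and *low* ones, so that no low predicate depends on a high one in $P$, $\mathtt{incorrect}$ is high, and a high predicate occurs in $G$. For a clause $C=(H\texttt{ :- }c,L,A,R)$ let $\mathit{Unf}(C,A)$ be the set of the clauses $(H\texttt{ :- }c,c_i,L,B_i,R)\vartheta_i$, where $K_i\texttt{ :- }c_i,B_i$ ranges over the (renamed apart) clauses of $P$ such that $A$ and $K_i$ are unifiable, with most general unifier $\vartheta_i$, and $(c,c_i)\vartheta_i$ is satisfiable. **The Transform strategy.** It is parameterized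 by a selection function, which says which body atoms of a clause are *unfoldable*, depending on the sequence of unfolding steps by which the clause has been derived, and by a generalization operator $\mathit{Gen}$. Initially $\mathit{TransfP}$ consists of the clauses of $P$ that define low predicates, and $\mathit{InDefs}=\mathit{Defs}=\{C_0\}$. While there is a clause $C$ in $\mathit{InDefs}$: 1. *Unfolding.* $\mathit{TransfC}:=\mathit{Unf}(C,A)$, where $A$ is the leftmost atom with high predicate in the body of $C$; then, while some $D\in\mathit{TransfC}$ has an unfoldable atom $B$ in its body, $\mathit{TransfC}:=(\mathit{TransfC}-\{D\})\cup\mathit{Unf}(D,B)$. 2. *Goal replacement.* In each clause of a chosen subset of $\mathit{TransfC}$, a constrained goal $c_1,G_1$ of the body may be replaced by $c_2,G_2$, provided that all predicates in $G_1$ and $G_2$ are low and $M(P)\models\forall(c_1,G_1\leftrightarrow c_2,G_2)$. More generally, $c_1,G_1$ may be replaced by a finite disjunction of constrained goals with low predicates that is equivalent to it in $M(P)$; the clause is then split into one clause per disjunct. 3. *Clause removal.* Remove the clauses with unsatisfiable constraints from $\mathit{TransfC}$, one by one. 4. *Definition and folding.* While there is in $\mathit{TransfC}$ a clause $E=(H\texttt{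 :- }e,L,Q,R)$ such that a high predicate occurs in the conjunction $Q$ and no predicate of $Q$ is the head predicate of a clause in $\mathit{Defs}$: if some $D=(N\texttt{ :- }d,B)$ in $\mathit{Defs}$ and some substitution $\vartheta$ satisfy (a) $Q=B\vartheta$, (b) $e\sqsubseteq d\vartheta$, (c) for each variable $x$ of $d,B$ not occurring in $N$, $x\vartheta$ is a variable that does not occur in $H,e,L,R$, nor in $z\vartheta$ for any other variable $z$ of $D$, then replace $E$ by $H\texttt{ :- }e,L,N\vartheta,R$ in $\mathit{TransfC}$, for one such $D$ and $\vartheta$. Otherwise let $D$ be the clause that $\mathit{Gen}$ returns for $E$, $Q$ and $\mathit{Defs}$; its head predicate is a high predicate that does not occur in $P\cup\mathit{Defs}$, and it satisfies (a)–(c) for some $\vartheta$; add $D$ to $\mathit{Defs}$ and to $\mathit{InDefs}$ and replace $E$ in the same way. 5. $\mathit{InDefs}:=\mathit{InDefs}-\{C\}$; $\mathit{TransfP}:=\mathit{TransfP}\cup\mathit{TransfC}$. Finally, remove from $\mathit{TransfP}$ all clauses whose head predicate is useless, i.e. belongs to the largest set $U$ of predicates occurring in $\mathit{TransfP}$ such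 that $p\in U$ iff every clause with head predicate $p$ has a body atom with predicate in $U$. The result is the output. **Theorem (Termination and Correctness of the Transform strategy).** (i) Assume that every sequence of clauses constructed by a first unfolding step and further unfolding steps with respect to unfoldable atoms is finite, and that only finitely many definitions are introduced along any execution. Then the Transform strategy terminates: whatever choices are made, every execution is finite, and it can end only by producing an output. (ii) For every output $\mathit{TransfP}$ of the Transform strategy on the input program $P$, $\mathtt{incorrect}\in M(P)$ iff $\mathtt{incorrect}\in M(\mathit{TransfP})$. -/

import Mathlib

universe u v

namespace CLP

/-! ### Terms, constraints, atoms, clauses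

`F` is the set of function symbols, `Pr` the set of predicate symbols.  The variables of programs
are natural numbers; expressions over the empty set of variables are the ground ones. -/

/-- First-order terms with variables in `V`, built from integer constants and function symbols
(a symbol may be used with several arities, as in Prolog). -/
inductive Term (F : Type u) (V : Type) : Type u
  | var (x : V) : Term F V
  | int (k : ℤ) : Term F V
  | app (f : F) (n : ℕ) (ts : Fin n → Term F V) : Term F V

/-- Ground terms: the elements of the domain of interpretation (they include the integers). -/
abbrev Ground (F : Type u) := Term F Empty

namespace Term

variable {F : Type u} {V W : Type}

/-- Application of a substitution (of a valuation, if `W` is empty). -/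
def subst (θ : V → Term F W) : Term F V → Term F W
  | var x => θ x
  | int k => int k
  | app f n ts => app f n (fun i => (ts i).subst θ)

/-- The variables that occur in a term. -/
def vars : Term F V → Set V
  | var x => {x}
  | int _ => ∅
  | app _ _ ts => ⋃ i, (ts i).vars

/-- The integer denoted by a term, if it is an integer. -/
def toInt? : Term F V → Option ℤ
  | int k => some k
  | _ => none

end Term

/-- Linear polynomials with integer coefficients.  The indeterminates of a program are variables;
other terms take their place when a substitution is applied. -/
inductive LinPoly (F : Type u) (V : Type) : Type u
  | const (k : ℤ) : LinPoly F V
  | monomial (k : ℤ) (t : Term F V) : LinPoly F V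
  | add (p q : LinPoly F V) : LinPoly F V

namespace LinPoly

variable {F : Type u} {V W : Type}

def subst (θ : V → Term F W) : LinPoly F V → LinPoly F W
  | const k => const k
  | monomial k t => monomial k (t.subst θ)
  | add p q => add (p.subst θ) (q.subst θ)

def vars : LinPoly F V → Set V
  | const _ => ∅
  | monomial _ t => t.vars
  | add p q => p.vars ∪ q.vars

/-- The integer value of a ground polynomial; there is none if an indeterminate has been replaced
by something that is not an integer. -/
def eval : LinPoly F Empty → Option ℤ
  | const k => some k
  | monomial k t => t.toInt?.map (fun m => k * m)
  | add p q => Option.map₂ (fun m n => m + n) p.eval q.eval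

end LinPoly

/-- The comparison symbols of atomic constraints. -/
inductive Cmp
  | eq | ne | lt | le | ge | gt

def Cmp.Holds : Cmp → ℤ → ℤ → Prop
  | eq, a, b => a = b
  | ne, a, b => a ≠ b
  | lt, a, b => a < b
  | le, a, b => a ≤ b
  | ge, a, b => a ≥ b
  | gt, a, b => a > b

/-- The constraint `false`, and the comparisons of two linear polynomials. -/
inductive AtomicConstraint (F : Type u) (V : Type) : Type u
  | falsum : AtomicConstraint F V
  | rel (r : Cmp) (p q : LinPoly F V) : AtomicConstraint F V

namespace AtomicConstraint

variable {F : Type u} {V W : Type}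

def subst (θ : V → Term F W) : AtomicConstraint F V → AtomicConstraint F W
  | falsum => falsum
  | rel r p q => rel r (p.subst θ) (q.subst θ)

def vars : AtomicConstraint F V → Set V
  | falsum => ∅
  | rel _ p q => p.vars ∪ q.vars

/-- Truth of a ground atomic constraint in the standard interpretation on the integers. -/
def Holds : AtomicConstraint F Empty → Prop
  | falsum => False
  | rel r p q => ∃ a ∈ p.eval, ∃ b ∈ q.eval, r.Holds a b

end AtomicConstraint

/-- A constraint is a conjunction of atomic constraints; `true` is the empty conjunction. -/
abbrev Constraint (F : Type u) (V : Type) := List (AtomicConstraint F V)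

namespace Constraint

variable {F : Type u} {V W : Type}

def subst (θ : V → Term F W) (c : Constraint F V) : Constraint F W :=
  c.map (AtomicConstraint.subst θ)

def vars (c : Constraint F V) : Set V := {x | ∃ a ∈ c, x ∈ a.vars}

def Holds (c : Constraint F Empty) : Prop := ∀ a ∈ c, a.Holds

/-- Some valuation makes the constraint true. -/
def Satisfiable (c : Constraint F V) : Prop := ∃ σ : V → Ground F, (subst σ c).Holds

/-- Entailment `c ⊑ d`: the universal closure of `c → d` is true. -/
def Entails (c d : Constraint F V) : Prop :=
  ∀ σ : V → Ground F, (subst σ c).Holds → (subst σ d).Holds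

end Constraint

/-- Atoms `p(t₁,…,tₙ)`. -/
structure Atom (F : Type u) (Pr : Type v) (V : Type) : Type (max u v) where
  pred : Pr
  args : List (Term F V)

namespace Atom

variable {F : Type u} {Pr : Type v} {V W : Type}

def subst (θ : V → Term F W) (A : Atom F Pr V) : Atom F Pr W :=
  ⟨A.pred, A.args.map (Term.subst θ)⟩

def vars (A : Atom F Pr V) : Set V := {x | ∃ t ∈ A.args, x ∈ t.vars}

end Atom

/-- Conjunctions of atoms. -/
abbrev Goal (F : Type u) (Pr : Type v) (V : Type) := List (Atom F Pr V)

namespace Goal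

variable {F : Type u} {Pr : Type v} {V W : Type}

def subst (θ : V → Term F W) (G : Goal F Pr V) : Goal F Pr W := G.map (Atom.subst θ)

def vars (G : Goal F Pr V) : Set V := {x | ∃ A ∈ G, x ∈ A.vars}

end Goal

/-- A clause `head :- constr, body`. -/
structure Clause (F : Type u) (Pr : Type v) : Type (max u v) where
  head : Atom F Pr ℕ
  constr : Constraint F ℕ
  body : Goal F Pr ℕ

noncomputable instance (F : Type u) (Pr : Type v) : DecidableEq (Clause F Pr) :=
  Classical.decEq _

/-- A program is a finite set of clauses. -/
abbrev Program (F : Type u) (Pr : Type v) := Finset (Clause F Pr)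

section Basic

variable {F : Type u} {Pr : Type v}

def Clause.subst (θ : ℕ → Term F ℕ) (C : Clause F Pr) : Clause F Pr :=
  ⟨C.head.subst θ, Constraint.subst θ C.constr, Goal.subst θ C.body⟩

def Clause.bodyVars (C : Clause F Pr) : Set ℕ := Constraint.vars C.constr ∪ Goal.vars C.body

def Clause.vars (C : Clause F Pr) : Set ℕ := C.head.vars ∪ C.bodyVars

/-- The predicate `p` occurs in the clause. -/
def Clause.Mentions (C : Clause F Pr) (p : Pr) : Prop :=
  C.head.pred = p ∨ ∃ A ∈ C.body, A.pred = p

/-- The predicate `p` occurs in the program. -/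
def Occurs (P : Program F Pr) (p : Pr) : Prop := ∃ C ∈ P, C.Mentions p

/-! ### Least model -/

/-- A set of ground atoms is a model of a program if it satisfies every ground instance of every
clause, constraints being interpreted in the standard way. -/
def IsModel (P : Program F Pr) (I : Set (Atom F Pr Empty)) : Prop :=
  ∀ C ∈ P, ∀ σ : ℕ → Ground F, (Constraint.subst σ C.constr).Holds →
    (∀ B ∈ C.body, B.subst σ ∈ I) → C.head.subst σ ∈ I

/-- The least model `M(P)`. -/
def leastModel (P : Program F Pr) : Set (Atom F Pr Empty) := ⋂₀ {I | IsModel P I}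

/-- Truth of the constrained goal `c, G` in `M(P)` under the valuation `σ`. -/
def TrueIn (P : Program F Pr) (σ : ℕ → Ground F) (c : Constraint F ℕ) (G : Goal F Pr ℕ) : Prop :=
  (Constraint.subst σ c).Holds ∧ ∀ B ∈ G, B.subst σ ∈ leastModel P

/-! ### Dependency and useless predicates -/

def ImmediatelyDependsOn (P : Program F Pr) (p q : Pr) : Prop :=
  ∃ C ∈ P, C.head.pred = p ∧ ∃ B ∈ C.body, B.pred = q

def DependsOn (P : Program F Pr) : Pr → Pr → Prop :=
  Relation.TransGen (ImmediatelyDependsOn P)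

/-- Sets `U` of predicates occurring in `P` such that `p ∈ U` iff every clause with head predicate
`p` has a body atom with predicate in `U`. -/
def IsUselessSet (P : Program F Pr) (U : Set Pr) : Prop :=
  ∀ p, p ∈ U ↔ Occurs P p ∧ ∀ C ∈ P, C.head.pred = p → ∃ B ∈ C.body, B.pred ∈ U

/-- Membership in the largest such set. -/
def Useless (P : Program F Pr) (p : Pr) : Prop := ∃ U, IsUselessSet P U ∧ p ∈ U

open Classical in
noncomputable def removeUseless (P : Program F Pr) : Program F Pr :=
  P.filter (fun C => ¬ Useless P C.head.pred)

open Classical in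
/-- The clauses of `P` that define low (that is, not high) predicates. -/
noncomputable def lowClauses (High : Pr → Prop) (P : Program F Pr) : Program F Pr :=
  P.filter (fun C => ¬ High C.head.pred)

/-! ### Unfolding -/

/-- `θ` is a most general unifier of `A` and `B`. -/
def IsMGU (θ : ℕ → Term F ℕ) (A B : Atom F Pr ℕ) : Prop :=
  A.subst θ = B.subst θ ∧
    ∀ η : ℕ → Term F ℕ, A.subst η = B.subst η → ∃ ξ : ℕ → Term F ℕ, ∀ x, η x = (θ x).subst ξ

/-- `D'` is derived from `D = H :- c, L, A, R` by unfolding with respect to `A`, using a renamed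
apart variant `K' = K₀ :- c', B` of the clause `K`: for a most general unifier `θ` of `A` and `K₀`
the constraint `(c, c')θ` is satisfiable and `D' = (H :- c, c', L, B, R)θ`. -/
def IsResolvent (D : Clause F Pr) (L : Goal F Pr ℕ) (A : Atom F Pr ℕ) (R : Goal F Pr ℕ)
    (K D' : Clause F Pr) : Prop :=
  ∃ (ρ : Equiv.Perm ℕ) (K' : Clause F Pr) (θ : ℕ → Term F ℕ),
    K' = K.subst (fun x => Term.var (ρ x)) ∧
    Disjoint K'.vars D.vars ∧
    IsMGU θ A K'.head ∧
    Constraint.Satisfiable (Constraint.subst θ (D.constr ++ K'.constr)) ∧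
    D' = Clause.subst θ ⟨D.head, D.constr ++ K'.constr, L ++ K'.body ++ R⟩

open Classical in
/-- `S` is the result `Unf(D, A)` of unfolding `D` with respect to the occurrence of `A` in its
body `L, A, R`: one clause for each clause of `P` with which `A` can be resolved.  The variants and
the most general unifiers may be chosen in any way. -/
def IsUnf (P : Program F Pr) (D : Clause F Pr) (L : Goal F Pr ℕ) (A : Atom F Pr ℕ)
    (R : Goal F Pr ℕ) (S : Finset (Clause F Pr)) : Prop :=
  ∃ g : Clause F Pr → Clause F Pr,
    (∀ K ∈ P, (∃ D', IsResolvent D L A R K D') → IsResolvent D L A R K (g K)) ∧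
    S = (P.filter (fun K => ∃ D', IsResolvent D L A R K D')).image g

end Basic

/-- A clause together with the sequence of unfolding steps (clause, position of the atom in the
body) through which it has been derived. -/
structure Derived (F : Type u) (Pr : Type v) : Type (max u v) where
  history : List (Clause F Pr × ℕ)
  clause : Clause F Pr

noncomputable instance (F : Type u) (Pr : Type v) : DecidableEq (Derived F Pr) :=
  Classical.decEq _

/-- A selection function: which body atoms (given by their positions) are unfoldable, depending on
the clause and on the way in which it has been derived. -/
abbrev Selection (F : Type u) (Pr : Type v) := Derived F Pr → ℕ → Prop

/-- A generalization operator maps a clause, the conjunction of body atoms that has to be folded,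
and the present set of definitions to a new definition. -/
abbrev GenOp (F : Type u) (Pr : Type v) :=
  Clause F Pr → Goal F Pr ℕ → Finset (Clause F Pr) → Clause F Pr

section Rules

variable {F : Type u} {Pr : Type v}

/-- The clause `E`, with history, that unfolding produces from `D` at the position `i`. -/
def Derived.extend (D : Derived F Pr) (i : ℕ) (E : Clause F Pr) : Derived F Pr :=
  ⟨D.history ++ [(D.clause, i)], E⟩

/-- `E` is one of the clauses that can be derived from `D` by unfolding an atom at position `i`. -/
def UnfoldsTo (P : Program F Pr) (D : Derived F Pr) (i : ℕ) (E : Derived F Pr) : Prop :=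
  ∃ L A R, D.clause.body = L ++ A :: R ∧ L.length = i ∧
    ∃ K ∈ P, ∃ C, IsResolvent D.clause L A R K C ∧ E = D.extend i C

/-- Every sequence of clauses constructed from a clause by a first unfolding step and then by
unfolding with respect to unfoldable atoms is finite. -/
def FiniteUnfolding (P : Program F Pr) (sel : Selection F Pr) : Prop :=
  ¬ ∃ s : ℕ → Derived F Pr,
      (s 0).history = [] ∧ (∃ i, UnfoldsTo P (s 0) i (s 1)) ∧
      ∀ n ≥ 1, ∃ i, sel (s n) i ∧ UnfoldsTo P (s n) i (s (n + 1))

/-! ### Goal replacement -/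

open Classical in
/-- `S` is obtained from `D` by replacing a constrained goal `c₁, G₁` that occurs in the body of
`D` by an equivalent one or, more generally, by a finite disjunction of constrained goals
(each disjunct giving rise to one clause).  Only low predicates occur in the goals. -/
def IsReplacement (P : Program F Pr) (High : Pr → Prop) (D : Clause F Pr)
    (S : Finset (Clause F Pr)) : Prop :=
  ∃ (c₁ c : Constraint F ℕ) (L G₁ R : Goal F Pr ℕ) (alts : List (Constraint F ℕ × Goal F Pr ℕ)),
    D.constr.Perm (c₁ ++ c) ∧ D.body.Perm (L ++ G₁ ++ R) ∧
    (∀ B ∈ G₁, ¬ High B.pred) ∧ (∀ a ∈ alts, ∀ B ∈ a.2, ¬ High B.pred) ∧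
    (∀ σ : ℕ → Ground F, TrueIn P σ c₁ G₁ ↔ ∃ a ∈ alts, TrueIn P σ a.1 a.2) ∧
    S = (alts.map (fun a => (⟨D.head, a.1 ++ c, L ++ a.2 ++ R⟩ : Clause F Pr))).toFinset

/-- The result of the goal replacement phase: each clause is left unchanged or is replaced. -/
def IsGoalReplacement (P : Program F Pr) (High : Pr → Prop) (T T' : Finset (Clause F Pr)) : Prop :=
  ∃ f : Clause F Pr → Finset (Clause F Pr),
    (∀ D ∈ T, f D = {D} ∨ IsReplacement P High D (f D)) ∧ T' = T.biUnion f

/-! ### Definition and folding -/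

/-- The body of `E = H :- e, L, Q, R` (up to the order of the atoms) contains the conjunction `Q`,
in which at least one high predicate occurs, and no atom of `Q` has a predicate that is already
defined by `Defs`. -/
def ToFold (High : Pr → Prop) (Defs : Finset (Clause F Pr)) (E : Clause F Pr)
    (L Q R : Goal F Pr ℕ) : Prop :=
  E.body.Perm (L ++ Q ++ R) ∧ (∃ B ∈ Q, High B.pred) ∧
    ∀ B ∈ Q, ∀ D ∈ Defs, D.head.pred ≠ B.pred

/-- `Q` can be folded in `E = H :- e, L, Q, R` by means of the clause `D = N :- d, G` and the
substitution `θ`: `Q = Gθ`, `e ⊑ dθ`, and, as usual for folding, each variable `x` of `d, G` that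
does not occur in `N` is mapped to a variable that does not occur in `H, e, L, R`, nor in `zθ` for
any other variable `z` of `D`. -/
def CanFold (E : Clause F Pr) (L Q R : Goal F Pr ℕ) (D : Clause F Pr) (θ : ℕ → Term F ℕ) : Prop :=
  Q = Goal.subst θ D.body ∧
  Constraint.Entails E.constr (Constraint.subst θ D.constr) ∧
  ∀ x ∈ D.bodyVars, x ∉ D.head.vars →
    ∃ y, θ x = Term.var y ∧
      y ∉ E.head.vars ∪ Constraint.vars E.constr ∪ Goal.vars L ∪ Goal.vars R ∧
      ∀ z ∈ D.vars, z ≠ x → y ∉ (θ z).vars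

/-- The clause `H :- e, L, Nθ, R` obtained by folding. -/
def folded (E : Clause F Pr) (L R : Goal F Pr ℕ) (D : Clause F Pr) (θ : ℕ → Term F ℕ) :
    Clause F Pr :=
  ⟨E.head, E.constr, L ++ D.head.subst θ :: R⟩

/-- The specification of a generalization operator: whenever a conjunction `Q` in the body of `E`
has to be folded and cannot be folded by a clause of `Defs`, the operator returns a clause whose
head has a high predicate symbol not occurring in `P ∪ Defs` and by which `Q` can be folded. -/
def IsGenOp (P : Program F Pr) (High : Pr → Prop) (Gen : GenOp F Pr) : Prop :=
  ∀ (E : Clause F Pr) (L Q R : Goal F Pr ℕ) (Defs : Finset (Clause F Pr)),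
    ToFold High Defs E L Q R → (¬ ∃ D ∈ Defs, ∃ θ, CanFold E L Q R D θ) →
    High (Gen E Q Defs).head.pred ∧ ¬ Occurs (P ∪ Defs) (Gen E Q Defs).head.pred ∧
      ∃ θ, CanFold E L Q R (Gen E Q Defs) θ

end Rules

/-! ### The Transform strategy as a transition system -/

/-- Control points.  The clause `C` is the definition being processed, `T` is the current value of
the variable `TransfC`. -/
inductive Phase (F : Type u) (Pr : Type v) : Type (max u v)
  | outer : Phase F Pr
  | unfolding (C : Clause F Pr) (T : Finset (Derived F Pr)) : Phase F Pr
  | replacing (C : Clause F Pr) (T : Finset (Clause F Pr)) : Phase F Pr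
  | removing (C : Clause F Pr) (T : Finset (Clause F Pr)) : Phase F Pr
  | folding (C : Clause F Pr) (T : Finset (Clause F Pr)) : Phase F Pr
  | halted : Phase F Pr

structure State (F : Type u) (Pr : Type v) : Type (max u v) where
  phase : Phase F Pr
  transfP : Program F Pr
  inDefs : Finset (Clause F Pr)
  defs : Finset (Clause F Pr)

section Strategy

variable {F : Type u} {Pr : Type v}

/-- The initial state for the program `P`, whose clause for `incorrect` is `C₀`.  The clauses of `P`
for the low predicates are carried along unchanged. -/
noncomputable def State.init (P : Program F Pr) (High : Pr → Prop) (C₀ : Clause F Pr) :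
    State F Pr :=
  ⟨.outer, lowClauses High P, {C₀}, {C₀}⟩

/-- One step of the strategy.  In the states, `X` is `TransfP`, `I` is `InDefs`, `Δ` is `Defs`. -/
inductive Step (P : Program F Pr) (High : Pr → Prop) (sel : Selection F Pr) (Gen : GenOp F Pr) :
    State F Pr → State F Pr → Prop
  /-- Take a clause `C` of `InDefs` and unfold it with respect to the leftmost high atom. -/
  | start {X : Program F Pr} {I Δ S : Finset (Clause F Pr)} {C : Clause F Pr}
      {L R : Goal F Pr ℕ} {A : Atom F Pr ℕ}
      (mem : C ∈ I) (split : C.body = L ++ A :: R) (high : High A.pred)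
      (leftmost : ∀ B ∈ L, ¬ High B.pred) (unf : IsUnf P C L A R S) :
      Step P High sel Gen ⟨.outer, X, I, Δ⟩
        ⟨.unfolding C (S.image ((⟨[], C⟩ : Derived F Pr).extend L.length)), X, I, Δ⟩
  /-- Unfold a clause of `TransfC` with respect to an unfoldable atom. -/
  | unfold {X : Program F Pr} {I Δ S : Finset (Clause F Pr)} {C : Clause F Pr}
      {T : Finset (Derived F Pr)} {D : Derived F Pr} {L R : Goal F Pr ℕ} {B : Atom F Pr ℕ}
      (mem : D ∈ T) (split : D.clause.body = L ++ B :: R) (unfoldable : sel D L.length)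
      (unf : IsUnf P D.clause L B R S) :
      Step P High sel Gen ⟨.unfolding C T, X, I, Δ⟩
        ⟨.unfolding C (T.erase D ∪ S.image (D.extend L.length)), X, I, Δ⟩
  | unfoldEnd {X : Program F Pr} {I Δ : Finset (Clause F Pr)} {C : Clause F Pr}
      {T : Finset (Derived F Pr)}
      (none : ∀ D ∈ T, ∀ i < D.clause.body.length, ¬ sel D i) :
      Step P High sel Gen ⟨.unfolding C T, X, I, Δ⟩
        ⟨.replacing C (T.image Derived.clause), X, I, Δ⟩
  | replace {X : Program F Pr} {I Δ T T' : Finset (Clause F Pr)} {C : Clause F Pr}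
      (repl : IsGoalReplacement P High T T') :
      Step P High sel Gen ⟨.replacing C T, X, I, Δ⟩ ⟨.removing C T', X, I, Δ⟩
  | remove {X : Program F Pr} {I Δ T : Finset (Clause F Pr)} {C E : Clause F Pr}
      (mem : E ∈ T) (unsat : ¬ Constraint.Satisfiable E.constr) :
      Step P High sel Gen ⟨.removing C T, X, I, Δ⟩ ⟨.removing C (T.erase E), X, I, Δ⟩
  | removeEnd {X : Program F Pr} {I Δ T : Finset (Clause F Pr)} {C : Clause F Pr}
      (none : ∀ E ∈ T, Constraint.Satisfiable E.constr) :
      Step P High sel Gen ⟨.removing C T, X, I, Δ⟩ ⟨.folding C T, X, I, Δ⟩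
  /-- Fold by means of a clause of `Defs`. -/
  | fold {X : Program F Pr} {I Δ T : Finset (Clause F Pr)} {C E D : Clause F Pr}
      {L Q R : Goal F Pr ℕ} {θ : ℕ → Term F ℕ}
      (mem : E ∈ T) (toFold : ToFold High Δ E L Q R) (memD : D ∈ Δ)
      (canFold : CanFold E L Q R D θ) :
      Step P High sel Gen ⟨.folding C T, X, I, Δ⟩
        ⟨.folding C (T.erase E ∪ {folded E L R D θ}), X, I, Δ⟩
  /-- If no clause of `Defs` can be used, introduce a new definition and fold by means of it. -/
  | define {X : Program F Pr} {I Δ T : Finset (Clause F Pr)} {C E : Clause F Pr}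
      {L Q R : Goal F Pr ℕ} {θ : ℕ → Term F ℕ}
      (mem : E ∈ T) (toFold : ToFold High Δ E L Q R)
      (none : ¬ ∃ D ∈ Δ, ∃ η, CanFold E L Q R D η)
      (canFold : CanFold E L Q R (Gen E Q Δ) θ) :
      Step P High sel Gen ⟨.folding C T, X, I, Δ⟩
        ⟨.folding C (T.erase E ∪ {folded E L R (Gen E Q Δ) θ}), X,
          I ∪ {Gen E Q Δ}, Δ ∪ {Gen E Q Δ}⟩
  | foldEnd {X : Program F Pr} {I Δ T : Finset (Clause F Pr)} {C : Clause F Pr}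
      (none : ∀ E ∈ T, ∀ L Q R, ¬ ToFold High Δ E L Q R) :
      Step P High sel Gen ⟨.folding C T, X, I, Δ⟩ ⟨.outer, X ∪ T, I.erase C, Δ⟩
  /-- When `InDefs` is empty, remove the useless clauses and halt. -/
  | halt {X : Program F Pr} {Δ : Finset (Clause F Pr)} :
      Step P High sel Gen ⟨.outer, X, ∅, Δ⟩ ⟨.halted, removeUseless X, ∅, Δ⟩

/-- The infinite executions that start from the state `s₀`. -/
def IsInfiniteRun (P : Program F Pr) (High : Pr → Prop) (sel : Selection F Pr) (Gen : GenOp F Pr)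
    (s₀ : State F Pr) (r : ℕ → State F Pr) : Prop :=
  r 0 = s₀ ∧ ∀ n, Step P High sel Gen (r n) (r (n + 1))

/-- Along every execution only finitely many definitions are introduced (along a finite execution
this is clear). -/
def FinitelyManyDefs (P : Program F Pr) (High : Pr → Prop) (sel : Selection F Pr)
    (Gen : GenOp F Pr) (s₀ : State F Pr) : Prop :=
  ∀ r, IsInfiniteRun P High sel Gen s₀ r → {D | ∃ n, D ∈ (r n).defs}.Finite

def Reachable (P : Program F Pr) (High : Pr → Prop) (sel : Selection F Pr) (Gen : GenOp F Pr) :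
    State F Pr → State F Pr → Prop :=
  Relation.ReflTransGen (Step P High sel Gen)

/-- Every execution from `s₀` is finite, and can only stop by halting. -/
def Terminates (P : Program F Pr) (High : Pr → Prop) (sel : Selection F Pr) (Gen : GenOp F Pr)
    (s₀ : State F Pr) : Prop :=
  (¬ ∃ r, IsInfiniteRun P High sel Gen s₀ r) ∧
  ∀ s, Reachable P High sel Gen s₀ s → (∀ s', ¬ Step P High sel Gen s s') → s.phase = .halted

/-- `O` is a possible output of the strategy started from `s₀`. -/
def IsOutput (P : Program F Pr) (High : Pr → Prop) (sel : Selection F Pr) (Gen : GenOp F Pr)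
    (s₀ : State F Pr) (O : Program F Pr) : Prop :=
  ∃ s, Reachable P High sel Gen s₀ s ∧ s.phase = .halted ∧ s.transfP = O

end Strategy

end CLP

/-! Correctness is proved by the weight method for unfold/fold transformations. Folding by
equivalences alone guarantees only soundness: a clause folded by its own definition may become
circular and derive nothing. Something must therefore decrease between a definition and the clauses
derived from it.

Let `Δ` be the set of all definitions at the end of the main loop. In `defModel P Δ` each defined
predicate means what its definition says over M(P), and every other predicate keeps its meaning in
M(P). The predicate of C₀ also keeps its meaning, because C₀ is its only clause in P
(`mem_defModel_iff_of_old`).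

Soundness: unfolding, goal replacement and folding preserve truth of the clauses in `defModel P Δ`.
So this interpretation is a model of the final set of clauses and contains its least model.

Completeness: give each true atom the least weight of a proof of it, where the weight counts high
atoms (`exists_weight`). A goal weighs the sum of its high atoms. The first unfolding step resolves
a high atom and lowers the weight strictly. Later unfolding steps do not raise it
(`IsUnf.complete`), goal replacement touches only atoms of weight zero, and folding does not raise
it if a defined atom gets the least weight of a true body instance of its definition
(`CanFold.complete`). Hence every true instance of a definition is derivable by a clause of the
result whose high body atoms are defined and weigh less, and strong induction on weight concludes
(`CorrectInv.head_mem_leastModel`). Removing useless predicates does not change the least model.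

Termination: each step decreases, lexicographically, the number of definitions not yet processed,
the position in the loop body, and a measure local to the phase (`Step.work_lt`). For unfolding this
measure is a rank in the multiset order over the well-founded part of the unfolding relation.
Progress (`DefsInv.exists_step`) shows that only a halted state has no successor. -/

namespace CLP

/-! ### Substitutions and variables -/

namespace Term

variable {F : Type u} {U V W : Type}

theorem subst_subst (θ : V → Term F W) (ξ : W → Term F U) (t : Term F V) :
    (t.subst θ).subst ξ = t.subst (fun x => (θ x).subst ξ) := by
  induction t with
  | var x => rfl
  | int k => rfl
  | app f n ts ih => simp only [subst, ih]

theorem subst_congr {θ θ' : V → Term F W} {t : Term F V} (h : ∀ x ∈ t.vars, θ x = θ' x) :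
    t.subst θ = t.subst θ' := by
  induction t with
  | var x => exact h x rfl
  | int k => rfl
  | app f n ts ih =>
    simp only [subst, app.injEq, heq_eq_eq, true_and]
    funext i
    exact ih i fun x hx => h x (Set.mem_iUnion.2 ⟨i, hx⟩)

theorem eq_of_subst_eq {θ θ' : V → Term F W} {t : Term F V} (h : t.subst θ = t.subst θ') :
    ∀ x ∈ t.vars, θ x = θ' x := by
  induction t with
  | var x => rintro _ rfl; exact h
  | int k => intro x hx; exact hx.elim
  | app f n ts ih =>
    intro x hx
    obtain ⟨i, hi⟩ := Set.mem_iUnion.1 hx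
    simp only [subst, app.injEq, heq_eq_eq, true_and] at h
    exact ih i (congrFun h i) x hi

theorem vars_subst (θ : V → Term F W) (t : Term F V) :
    (t.subst θ).vars = ⋃ x ∈ t.vars, (θ x).vars := by
  induction t with
  | var x => simp [subst, vars]
  | int k => simp [subst, vars]
  | app f n ts ih =>
    simp only [subst, vars, ih]
    ext y
    simp only [Set.mem_iUnion, exists_prop]
    exact ⟨fun ⟨i, x, h⟩ => ⟨x, ⟨i, h.1⟩, h.2⟩, fun ⟨x, ⟨i, h⟩, h'⟩ => ⟨i, x, h, h'⟩⟩

theorem finite_vars (t : Term F V) : t.vars.Finite := by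
  induction t with
  | var x => exact Set.finite_singleton x
  | int k => exact Set.finite_empty
  | app f n ts ih => exact Set.finite_iUnion ih

theorem subst_of_ground (σ : Empty → Term F Empty) (t : Ground F) : t.subst σ = t := by
  induction t with
  | var x => exact x.elim
  | int k => rfl
  | app f n ts ih => simp only [subst, ih]

end Term

namespace LinPoly

variable {F : Type u} {U V W : Type}

theorem subst_subst (θ : V → Term F W) (ξ : W → Term F U) (p : LinPoly F V) :
    (p.subst θ).subst ξ = p.subst (fun x => (θ x).subst ξ) := by
  induction p with
  | const k => rfl
  | monomial k t => simp only [subst, Term.subst_subst]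
  | add p q hp hq => simp only [subst, hp, hq]

theorem subst_congr {θ θ' : V → Term F W} {p : LinPoly F V} (h : ∀ x ∈ p.vars, θ x = θ' x) :
    p.subst θ = p.subst θ' := by
  induction p with
  | const k => rfl
  | monomial k t => simp only [subst, Term.subst_congr (t := t) h]
  | add p q hp hq =>
    simp only [subst, hp fun x hx => h x (.inl hx), hq fun x hx => h x (.inr hx)]

theorem vars_subst (θ : V → Term F W) (p : LinPoly F V) :
    (p.subst θ).vars = ⋃ x ∈ p.vars, (θ x).vars := by
  induction p with
  | const k => simp [subst, vars]
  | monomial k t => exact t.vars_subst θ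
  | add p q hp hq => simp only [subst, vars, hp, hq, Set.biUnion_union]

theorem finite_vars (p : LinPoly F V) : p.vars.Finite := by
  induction p with
  | const k => exact Set.finite_empty
  | monomial k t => exact t.finite_vars
  | add p q hp hq => exact hp.union hq

end LinPoly

namespace AtomicConstraint

variable {F : Type u} {U V W : Type}

theorem subst_subst (θ : V → Term F W) (ξ : W → Term F U) (a : AtomicConstraint F V) :
    (a.subst θ).subst ξ = a.subst (fun x => (θ x).subst ξ) := by
  cases a with
  | falsum => rfl
  | rel r p q => simp only [subst, LinPoly.subst_subst]

theorem subst_congr {θ θ' : V → Term F W} {a : AtomicConstraint F V}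
    (h : ∀ x ∈ a.vars, θ x = θ' x) : a.subst θ = a.subst θ' := by
  cases a with
  | falsum => rfl
  | rel r p q =>
    simp only [subst, LinPoly.subst_congr (p := p) fun x hx => h x (.inl hx),
      LinPoly.subst_congr (p := q) fun x hx => h x (.inr hx)]

theorem vars_subst (θ : V → Term F W) (a : AtomicConstraint F V) :
    (a.subst θ).vars = ⋃ x ∈ a.vars, (θ x).vars := by
  cases a with
  | falsum => simp [subst, vars]
  | rel r p q => simp only [subst, vars, LinPoly.vars_subst, Set.biUnion_union]

theorem finite_vars (a : AtomicConstraint F V) : a.vars.Finite := by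
  cases a with
  | falsum => exact Set.finite_empty
  | rel r p q => exact p.finite_vars.union q.finite_vars

end AtomicConstraint

theorem finite_setOf_exists_mem {α : Type*} {V : Type} (l : List α) (f : α → Set V)
    (h : ∀ a, (f a).Finite) : {x | ∃ a ∈ l, x ∈ f a}.Finite := by
  have : {x | ∃ a ∈ l, x ∈ f a} = ⋃ a ∈ {a | a ∈ l}, f a := by ext; simp
  rw [this]
  exact (List.finite_toSet l).biUnion fun a _ => h a

theorem setOf_exists_mem_map {α β : Type*} {V W : Type} {f : α → Set V} {g : β → Set W}
    {h : V → Set W} {m : α → β} (hm : ∀ a, g (m a) = ⋃ x ∈ f a, h x) (l : List α) :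
    {y | ∃ b ∈ l.map m, y ∈ g b} = ⋃ x ∈ {x | ∃ a ∈ l, x ∈ f a}, h x := by
  ext y
  simp only [List.mem_map, exists_exists_and_eq_and, hm, Set.mem_iUnion, exists_prop,
    Set.mem_ofPred_eq]
  exact ⟨fun ⟨a, ha, x, h⟩ => ⟨x, ⟨a, ha, h.1⟩, h.2⟩, fun ⟨x, ⟨a, ha, h⟩, h'⟩ => ⟨a, ha, x, h, h'⟩⟩

namespace Constraint

variable {F : Type u} {U V W : Type}

theorem subst_subst (θ : V → Term F W) (ξ : W → Term F U) (c : Constraint F V) :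
    subst ξ (subst θ c) = subst (fun x => (θ x).subst ξ) c := by
  simp only [subst, List.map_map]
  exact List.map_congr_left fun a _ => a.subst_subst θ ξ

theorem subst_congr {θ θ' : V → Term F W} {c : Constraint F V} (h : ∀ x ∈ vars c, θ x = θ' x) :
    subst θ c = subst θ' c :=
  List.map_congr_left fun a ha => AtomicConstraint.subst_congr fun x hx => h x ⟨a, ha, hx⟩

theorem vars_subst (θ : V → Term F W) (c : Constraint F V) :
    vars (subst θ c) = ⋃ x ∈ vars c, (θ x).vars :=
  setOf_exists_mem_map (fun a => a.vars_subst θ) c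

theorem finite_vars (c : Constraint F V) : (vars c).Finite :=
  finite_setOf_exists_mem c _ AtomicConstraint.finite_vars

theorem holds_subst_append (σ : V → Ground F) (c d : Constraint F V) :
    (subst σ (c ++ d)).Holds ↔ (subst σ c).Holds ∧ (subst σ d).Holds := by
  simp only [subst, Holds, List.map_append, List.mem_append, or_imp, forall_and]

theorem holds_subst_perm {σ : V → Ground F} {c d : Constraint F V} (h : c.Perm d) :
    (subst σ c).Holds ↔ (subst σ d).Holds := by
  simp only [subst, Holds, (h.map _).mem_iff]

end Constraint

namespace Atom

variable {F : Type u} {Pr : Type v} {U V W : Type}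

theorem subst_subst (θ : V → Term F W) (ξ : W → Term F U) (A : Atom F Pr V) :
    (A.subst θ).subst ξ = A.subst (fun x => (θ x).subst ξ) := by
  simp only [subst, List.map_map, mk.injEq, true_and]
  exact List.map_congr_left fun t _ => t.subst_subst θ ξ

theorem subst_congr {θ θ' : V → Term F W} {A : Atom F Pr V} (h : ∀ x ∈ A.vars, θ x = θ' x) :
    A.subst θ = A.subst θ' := by
  simp only [subst, mk.injEq, true_and]
  exact List.map_congr_left fun t ht => Term.subst_congr fun x hx => h x ⟨t, ht, hx⟩

theorem eq_of_subst_eq {θ θ' : V → Term F W} {A : Atom F Pr V} (h : A.subst θ = A.subst θ') :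
    ∀ x ∈ A.vars, θ x = θ' x := by
  rintro x ⟨t, ht, hx⟩
  simp only [subst, mk.injEq, true_and] at h
  exact Term.eq_of_subst_eq (List.map_inj_left.1 h t ht) x hx

theorem vars_subst (θ : V → Term F W) (A : Atom F Pr V) :
    (A.subst θ).vars = ⋃ x ∈ A.vars, (θ x).vars :=
  setOf_exists_mem_map (fun t => t.vars_subst θ) A.args

theorem finite_vars (A : Atom F Pr V) : A.vars.Finite :=
  finite_setOf_exists_mem A.args _ Term.finite_vars

end Atom

theorem Goal.vars_subst {F : Type u} {Pr : Type v} {V W : Type} (θ : V → Term F W)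
    (G : Goal F Pr V) : vars (subst θ G) = ⋃ x ∈ vars G, (θ x).vars :=
  setOf_exists_mem_map (fun A => A.vars_subst θ) G

/-! ### Renaming clauses apart; the least model -/

section

variable {F : Type u} {Pr : Type v}

theorem Clause.finite_vars (C : Clause F Pr) : C.vars.Finite :=
  C.head.finite_vars.union (C.constr.finite_vars.union
    (finite_setOf_exists_mem C.body _ Atom.finite_vars))

theorem Clause.vars_subst (θ : ℕ → Term F ℕ) (C : Clause F Pr) :
    (C.subst θ).vars = ⋃ x ∈ C.vars, (θ x).vars := by
  simp only [vars, bodyVars, subst, Atom.vars_subst, Constraint.vars_subst, Goal.vars_subst,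
    Set.biUnion_union]

/-- Clauses can be renamed apart. -/
theorem Clause.exists_perm_disjoint (K D : Clause F Pr) :
    ∃ ρ : Equiv.Perm ℕ, Disjoint (K.subst (fun x => Term.var (ρ x))).vars D.vars := by
  obtain ⟨N, hN⟩ := (K.finite_vars.union D.finite_vars).bddAbove
  have hlt : ∀ x ∈ K.vars ∪ D.vars, x < N + 1 := fun x hx => Nat.lt_succ_of_le (hN hx)
  -- The involution exchanges the block of numbers up to `N`, which holds all variables of both
  -- clauses, with the next block of the same length.
  let f : ℕ → ℕ := fun x => if x < N + 1 then x + (N + 1) else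
    if x < 2 * (N + 1) then x - (N + 1) else x
  have hf : Function.Involutive f := by
    intro x
    simp only [f]
    split_ifs <;> omega
  refine ⟨hf.toPerm, Set.disjoint_left.2 fun y hy hyD => ?_⟩
  rw [vars_subst] at hy
  simp only [Set.mem_iUnion, Term.vars, Set.mem_singleton_iff, exists_prop] at hy
  obtain ⟨x, hx, rfl⟩ := hy
  have h₁ := hlt x (.inl hx)
  have h₂ := hlt _ (.inr hyD)
  simp only [Function.Involutive.coe_toPerm, f, if_pos h₁] at h₂
  omega

theorem leastModel_isModel (P : Program F Pr) : IsModel P (leastModel P) := by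
  intro C hC σ hc hb I hI
  exact hI C hC σ hc fun B hB => hb B hB I hI

theorem leastModel_subset {P : Program F Pr} {I : Set (Atom F Pr Empty)} (h : IsModel P I) :
    leastModel P ⊆ I := Set.sInter_subset_of_mem h

theorem trueIn_subst {P : Program F Pr} {θ : ℕ → Term F ℕ} {σ : ℕ → Ground F}
    {c : Constraint F ℕ} {G : Goal F Pr ℕ} :
    TrueIn P σ (Constraint.subst θ c) (Goal.subst θ G) ↔
      TrueIn P (fun x => (θ x).subst σ) c G := by
  simp only [TrueIn, Constraint.subst_subst, Goal.subst, List.forall_mem_map, Atom.subst_subst]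

end

/-! ### Most general unifiers

A most general unifier of two unifiable atoms is obtained as the anti-unifier (least common
generalization) of all their unifiers. -/

namespace Term

variable {F : Type u} {I : Type u}

/-- The `j`-th argument of a term. -/
def arg (j : ℕ) : Term F ℕ → Term F ℕ
  | app _ n ts => if h : j < n then ts ⟨j, h⟩ else int 0
  | _ => int 0

/-- The family of the subterms at the same position of the terms of a family. -/
def subfamily (u : I → Term F ℕ) (p : List ℕ) : I → Term F ℕ :=
  p.foldl (fun w j i => (w i).arg j) u

open Classical in
/-- The least common generalization of the family `u`, by recursion on one of its members. The
variable `enc w` stands for the family `w` of terms. -/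
noncomputable def antiUnify (enc : (I → Term F ℕ) → ℕ) :
    Term F ℕ → (I → Term F ℕ) → Term F ℕ
  | var _, u => var (enc u)
  | int k, u => if ∀ i, u i = int k then int k else var (enc u)
  | app f n ts, u =>
    if ∀ i, ∃ us, u i = app f n us then
      app f n (fun j => antiUnify enc (ts j) (fun i => (u i).arg j))
    else var (enc u)

/-- On a family of instances of `t`, generalization only descends along `t` until it reaches the
variables. So the generalization of all unifiers acts on a term by generalizing the family of its
instances. Two terms with the same instances are therefore unified by it. -/
theorem antiUnify_subst (enc : (I → Term F ℕ) → ℕ) (η : I → ℕ → Term F ℕ) (i₀ : I)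
    (t : Term F ℕ) :
    antiUnify enc (t.subst (η i₀)) (fun i => t.subst (η i)) =
      t.subst (fun x => antiUnify enc (η i₀ x) (fun i => η i x)) := by
  induction t with
  | var x => rfl
  | int k => simp [subst, antiUnify]
  | app f n ts ih =>
    simp only [subst, antiUnify]
    rw [if_pos fun i => ⟨_, rfl⟩]
    congr 1
    funext j
    simp only [arg, j.isLt, dif_pos, Fin.eta]
    exact ih j

/-- Each variable of the generalization codes a family of subterms, and decoding it at index `i`
returns the `i`-th subterm. The set `S` contains all families met in the recursion; only there need
`enc` be injective. -/
theorem subst_antiUnify {enc : (I → Term F ℕ) → ℕ} {dec : ℕ → I → Term F ℕ}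
    {S : Set (I → Term F ℕ)} (hS : ∀ u ∈ S, ∀ j, (fun i => (u i).arg j) ∈ S)
    (hdec : ∀ u ∈ S, dec (enc u) = u) (i₀ i : I) {t : Term F ℕ} {u : I → Term F ℕ}
    (hu : u ∈ S) (ht : u i₀ = t) : (antiUnify enc t u).subst (fun x => dec x i) = u i := by
  have key : ∀ w ∈ S, (var (enc w) : Term F ℕ).subst (fun x => dec x i) = w i := by
    intro w hw
    simp only [subst, hdec w hw]
  induction t generalizing u with
  | var x => exact key u hu
  | int k =>
    simp only [antiUnify]
    split_ifs with h
    · exact (h i).symm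
    · exact key u hu
  | app f n ts ih =>
    simp only [antiUnify]
    split_ifs with h
    · obtain ⟨us, hus⟩ := h i
      simp only [subst, hus, app.injEq, heq_eq_eq, true_and]
      funext j
      rw [ih j (hS u hu j) (by simp [ht, arg]), hus]
      simp [arg]
    · exact key u hu

end Term

variable {F : Type u} {Pr : Type v}

open Term in
-- All unifiers form one family, indexed by themselves, and its generalization is taken at each
-- variable. It is a unifier by `antiUnify_subst`, and every unifier is an instance of it by
-- `subst_antiUnify`. No unification algorithm or occurs check is needed, since one unifier is
-- given.
theorem exists_isMGU {A B : Atom F Pr ℕ} {η₀ : ℕ → Term F ℕ}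
    (h : A.subst η₀ = B.subst η₀) : ∃ θ, IsMGU θ A B := by
  classical
  let I := {η : ℕ → Term F ℕ // A.subst η = B.subst η}
  let i₀ : I := ⟨η₀, h⟩
  -- There may be uncountably many families indexed by the unifiers, but only those at a position
  -- below a variable are needed. They are countably many, so natural numbers suffice as their
  -- codes.
  let S : Set (I → Term F ℕ) := Set.range fun q : ℕ × List ℕ => subfamily (fun i => i.1 q.1) q.2
  have hS : ∀ u ∈ S, ∀ j, (fun i => (u i).arg j) ∈ S := by
    rintro _ ⟨⟨x, p⟩, rfl⟩ j
    exact ⟨⟨x, p ++ [j]⟩, by simp [subfamily]⟩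
  have hxS : ∀ x, (fun i : I => i.1 x) ∈ S := fun x => ⟨(x, []), rfl⟩
  obtain ⟨dec, hdec⟩ := (Set.countable_range _ : S.Countable).exists_eq_range ⟨_, hxS 0⟩
  have hmem : ∀ u ∈ S, ∃ n, dec n = u := fun u hu => by
    have : u ∈ Set.range dec := hdec ▸ hu
    exact this
  let enc : (I → Term F ℕ) → ℕ := fun u => if hu : ∃ n, dec n = u then hu.choose else 0
  have hde : ∀ u ∈ S, dec (enc u) = u := by
    intro u hu
    simp only [enc, dif_pos (hmem u hu)]
    exact (hmem u hu).choose_spec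
  refine ⟨fun x => antiUnify enc (η₀ x) (fun i : I => i.1 x), ?_, fun η hη =>
    ⟨fun n => dec n ⟨η, hη⟩, fun x => (subst_antiUnify hS hde i₀ ⟨η, hη⟩ (hxS x) rfl).symm⟩⟩
  have hpred : A.pred = B.pred := congrArg (fun C => C.pred) h
  have hargs : ∀ i : I, A.args.map (Term.subst i.1) = B.args.map (Term.subst i.1) :=
    fun i => congrArg Atom.args i.2
  have hsub : ∀ C : Atom F Pr ℕ, C.subst (fun x => antiUnify enc (η₀ x) (fun i : I => i.1 x)) =
      ⟨C.pred, C.args.map fun t => antiUnify enc (t.subst η₀) (fun i : I => t.subst i.1)⟩ := by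
    intro C
    simp only [Atom.subst, Atom.mk.injEq, true_and]
    exact List.map_congr_left fun t _ => (antiUnify_subst enc (fun i : I => i.1) i₀ t).symm
  rw [hsub, hsub, Atom.mk.injEq]
  refine ⟨hpred, List.ext_getElem (by simpa using congrArg List.length (hargs i₀)) ?_⟩
  intro k h₁ h₂
  simp only [List.getElem_map]
  have hk : ∀ i : I, (A.args[k]'(by simpa using h₁)).subst i.1 =
      (B.args[k]'(by simpa using h₂)).subst i.1 := by
    intro i
    have := List.getElem_of_eq (hargs i) (i := k) (by simpa using h₁)
    simpa only [List.getElem_map] using this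
  have hk₀ := hk i₀
  simp only [i₀] at hk₀
  rw [funext hk, hk₀]

/-! ### Weights of goals -/

section GoalWt

variable {High : Pr → Prop} {wt : Atom F Pr Empty → ℕ} {σ : ℕ → Ground F}

open Classical in
/-- The sum of the weights of the high atoms of a goal. -/
noncomputable def goalWt (High : Pr → Prop) (wt : Atom F Pr Empty → ℕ) (σ : ℕ → Ground F)
    (G : Goal F Pr ℕ) : ℕ :=
  (G.map fun B => if High B.pred then wt (B.subst σ) else 0).sum

theorem goalWt_append (G G' : Goal F Pr ℕ) :
    goalWt High wt σ (G ++ G') = goalWt High wt σ G + goalWt High wt σ G' := by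
  simp only [goalWt, List.map_append, List.sum_append]

theorem goalWt_perm {G G' : Goal F Pr ℕ} (h : G.Perm G') :
    goalWt High wt σ G = goalWt High wt σ G' := (h.map _).sum_eq

theorem goalWt_eq_zero {G : Goal F Pr ℕ} (h : ∀ B ∈ G, ¬ High B.pred) :
    goalWt High wt σ G = 0 := by
  refine List.sum_eq_zero fun n hn => ?_
  obtain ⟨B, hB, rfl⟩ := List.mem_map.1 hn
  exact if_neg (h B hB)

theorem goalWt_subst (θ : ℕ → Term F ℕ) (G : Goal F Pr ℕ) :
    goalWt High wt σ (Goal.subst θ G) = goalWt High wt (fun x => (θ x).subst σ) G := by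
  simp only [goalWt, Goal.subst, List.map_map]
  congr 1
  refine List.map_congr_left fun B _ => ?_
  simp only [Function.comp_apply, Atom.subst_subst]
  rfl

theorem goalWt_congr {σ' : ℕ → Ground F} {G : Goal F Pr ℕ}
    (h : ∀ B ∈ G, B.subst σ = B.subst σ') : goalWt High wt σ G = goalWt High wt σ' G := by
  simp only [goalWt]
  congr 1
  exact List.map_congr_left fun B hB => by rw [h B hB]

theorem goalWt_le_goalWt {wt' : Atom F Pr Empty → ℕ} {G : Goal F Pr ℕ}
    (h : ∀ B ∈ G, High B.pred → wt (B.subst σ) ≤ wt' (B.subst σ)) :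
    goalWt High wt σ G ≤ goalWt High wt' σ G := by
  refine List.sum_le_sum fun B hB => ?_
  split_ifs with hh
  · exact h B hB hh
  · exact le_rfl

theorem le_goalWt {G : Goal F Pr ℕ} {B : Atom F Pr ℕ} (hB : B ∈ G) (hh : High B.pred) :
    wt (B.subst σ) ≤ goalWt High wt σ G := by
  refine List.single_le_sum (fun _ _ => Nat.zero_le _) _ (List.mem_map.2 ⟨B, hB, ?_⟩)
  exact if_pos hh

theorem goalWt_singleton_high {B : Atom F Pr ℕ} (hh : High B.pred) :
    goalWt High wt σ [B] = wt (B.subst σ) := by simp [goalWt, hh]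

end GoalWt

/-- Weighted derivability from `P`: the weight counts the occurrences of high atoms in a proof. -/
inductive HasWeight (P : Program F Pr) (High : Pr → Prop) : Atom F Pr Empty → ℕ → Prop
  | mk (C : Clause F Pr) (hC : C ∈ P) (σ : ℕ → Ground F) (w : Atom F Pr Empty → ℕ)
      (hc : (Constraint.subst σ C.constr).Holds)
      (hb : ∀ B ∈ C.body, HasWeight P High (B.subst σ) (w (B.subst σ))) :
      HasWeight P High (C.head.subst σ) (goalWt High w σ C.body + 1)

/-- Each true atom is heavier than the body of some clause instance from which it can be
derived. -/
def IsWeight (P : Program F Pr) (High : Pr → Prop) (wt : Atom F Pr Empty → ℕ) : Prop :=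
  ∀ A ∈ leastModel P, ∃ C ∈ P, ∃ σ, C.head.subst σ = A ∧ TrueIn P σ C.constr C.body ∧
    goalWt High wt σ C.body < wt A

theorem exists_weight (P : Program F Pr) (High : Pr → Prop) :
    ∃ wt, IsWeight P High wt := by
  classical
  have hex : ∀ A ∈ leastModel P, ∃ n, HasWeight P High A n := by
    refine leastModel_subset (I := {A | ∃ n, HasWeight P High A n}) fun C hC σ hc hb => ?_
    -- One weight is fixed per ground atom, so equal body atoms get equal weights; the default 0 is
    -- never taken on the body.
    let w : Atom F Pr Empty → ℕ := fun A => if h : ∃ n, HasWeight P High A n then h.choose else 0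
    refine ⟨_, .mk C hC σ w hc fun B hB => ?_⟩
    have : w (B.subst σ) = (hb B hB).choose := dif_pos _
    rw [this]
    exact (hb B hB).choose_spec
  have htrue : ∀ A n, HasWeight P High A n → A ∈ leastModel P := by
    intro A n h
    induction h with
    | mk C hC σ w hc hb ih => exact leastModel_isModel P C hC σ hc ih
  refine ⟨fun A => sInf {n | HasWeight P High A n}, fun A hA => ?_⟩
  have hmin : HasWeight P High A (sInf {n | HasWeight P High A n}) := Nat.sInf_mem (hex A hA)
  -- The minimum is named so that the derivation can be inverted. Its last clause instance is the
  -- one sought: minimal weights of the body atoms do not exceed those used in the derivation, and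
  -- the added 1 makes the inequality strict.
  obtain ⟨m, hm⟩ : ∃ m, m = sInf {n | HasWeight P High A n} := ⟨_, rfl⟩
  dsimp only
  rw [← hm] at hmin ⊢
  cases hmin with
  | mk C hC σ w hc hb =>
    refine ⟨C, hC, σ, rfl, ⟨hc, fun B hB => htrue _ _ (hb B hB)⟩, Nat.lt_succ_of_le ?_⟩
    exact goalWt_le_goalWt fun B hB _ => Nat.sInf_le (hb B hB)

/-! ### Correctness of unfolding -/

theorem IsResolvent.sound {P : Program F Pr} {D K D' : Clause F Pr} {L R : Goal F Pr ℕ}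
    {A : Atom F Pr ℕ} (h : IsResolvent D L A R K D') (hK : K ∈ P) (hD : D.body = L ++ A :: R)
    {σ : ℕ → Ground F} (hσ : TrueIn P σ D'.constr D'.body) :
    ∃ σ', D.head.subst σ' = D'.head.subst σ ∧ TrueIn P σ' D.constr D.body := by
  obtain ⟨ρ, K', θ, rfl, -, hθ, -, rfl⟩ := h
  refine ⟨fun x => (θ x).subst σ, (Atom.subst_subst _ _ _).symm, ?_⟩
  obtain ⟨hc, hb⟩ := trueIn_subst.1 hσ
  rw [Constraint.holds_subst_append] at hc
  refine ⟨hc.1, fun B hB => ?_⟩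
  have hA : A.subst (fun x => (θ x).subst σ) ∈ leastModel P := by
    rw [← Atom.subst_subst, hθ.1, Atom.subst_subst]
    simp only [Clause.subst, Atom.subst_subst]
    refine leastModel_isModel P K hK _ ?_ fun B hB => ?_
    · have := hc.2
      simpa only [Clause.subst, Constraint.subst_subst] using this
    · have := hb (B.subst fun x => .var (ρ x)) (by
        simp only [List.mem_append]
        exact .inl (.inr (List.mem_map_of_mem hB)))
      simpa only [Atom.subst_subst] using this
  rw [hD, List.mem_append, List.mem_cons] at hB
  rcases hB with hB | rfl | hB
  · exact hb B (by simp [hB])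
  · exact hA
  · exact hb B (by simp [hB])

/-- Renaming apart lets one valuation serve both the clause to be unfolded and the clause resolved
with it. -/
theorem exists_common_valuation {K D : Clause F Pr} {ρ : Equiv.Perm ℕ}
    (hd : Disjoint (K.subst (fun x => Term.var (ρ x))).vars D.vars) (σ σK : ℕ → Ground F) :
    ∃ τ : ℕ → Ground F, (∀ x ∈ D.vars, τ x = σ x) ∧ ∀ x ∈ K.vars, τ (ρ x) = σK x := by
  classical
  refine ⟨fun x => if x ∈ D.vars then σ x else σK (ρ.symm x), fun x hx => if_pos hx,
    fun x hx => ?_⟩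
  have : ρ x ∈ (K.subst (fun x => Term.var (ρ x))).vars := by
    rw [Clause.vars_subst]
    exact Set.mem_biUnion hx rfl
  simp only [if_neg (Set.disjoint_left.1 hd this), Equiv.symm_apply_apply]

theorem exists_isMGU_of_ground {A B : Atom F Pr ℕ} {τ : ℕ → Ground F}
    (h : A.subst τ = B.subst τ) : ∃ θ, IsMGU θ A B := by
  refine exists_isMGU (η₀ := fun x => (τ x).subst Empty.elim) ?_
  rw [← Atom.subst_subst, ← Atom.subst_subst, h]

theorem IsMGU.exists_ground {A B : Atom F Pr ℕ} {θ : ℕ → Term F ℕ} (hθ : IsMGU θ A B)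
    {τ : ℕ → Ground F} (h : A.subst τ = B.subst τ) :
    ∃ ξ : ℕ → Ground F, τ = fun x => (θ x).subst ξ := by
  obtain ⟨ξ, hξ⟩ := hθ.2 (fun x => (τ x).subst Empty.elim)
    (by rw [← Atom.subst_subst, ← Atom.subst_subst, h])
  -- The most general unifier factors the ground unifier through a substitution that may still
  -- contain variables. Sending these to 0 is harmless, since the values of `τ` are ground.
  refine ⟨fun y => (ξ y).subst fun _ => .int 0, funext fun x => ?_⟩
  rw [← Term.subst_subst, ← hξ, Term.subst_subst, Term.subst_of_ground]

section

variable {P : Program F Pr} {High : Pr → Prop} {wt : Atom F Pr Empty → ℕ} {D K : Clause F Pr}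
  {L R : Goal F Pr ℕ} {A : Atom F Pr ℕ} {σ σK : ℕ → Ground F}

/-- The ground picture of a resolution step, before any unifier is chosen: under the common
valuation the selected atom and the renamed head coincide, the joined body is true, and in its
weight `A` is replaced by the body of `K`. -/
theorem trueIn_variant {ρ : Equiv.Perm ℕ} {τ : ℕ → Ground F} (hD : D.body = L ++ A :: R)
    (hσ : TrueIn P σ D.constr D.body) (hK : TrueIn P σK K.constr K.body)
    (hA : K.head.subst σK = A.subst σ)
    (hτD : ∀ x ∈ D.vars, τ x = σ x) (hτK : ∀ x ∈ K.vars, τ (ρ x) = σK x) :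
    A.subst τ = (K.subst fun x => Term.var (ρ x)).head.subst τ ∧
    D.head.subst τ = D.head.subst σ ∧
    TrueIn P τ (D.constr ++ (K.subst fun x => Term.var (ρ x)).constr)
      (L ++ (K.subst fun x => Term.var (ρ x)).body ++ R) ∧
    goalWt High wt τ (L ++ (K.subst fun x => Term.var (ρ x)).body ++ R) =
      goalWt High wt σ L + goalWt High wt σK K.body + goalWt High wt σ R := by
  have hbD : ∀ B ∈ D.body, B.subst τ = B.subst σ := fun B hB =>
    Atom.subst_congr fun x hx => hτD x (.inr (.inr ⟨B, hB, hx⟩))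
  have hbK : ∀ B ∈ K.body, (B.subst fun x => Term.var (ρ x)).subst τ = B.subst σK := by
    intro B hB
    rw [Atom.subst_subst]
    exact Atom.subst_congr fun x hx => hτK x (.inr (.inr ⟨B, hB, hx⟩))
  have hLD : ∀ B ∈ L, B ∈ D.body := fun B hB => by rw [hD]; simp [hB]
  have hRD : ∀ B ∈ R, B ∈ D.body := fun B hB => by rw [hD]; simp [hB]
  refine ⟨?_, Atom.subst_congr fun x hx => hτD x (.inl hx), ⟨?_, ?_⟩, ?_⟩
  · rw [hbD A (by rw [hD]; simp), ← hA]
    simp only [Clause.subst, Atom.subst_subst]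
    exact (Atom.subst_congr fun x hx => hτK x (.inl hx)).symm
  · rw [Constraint.holds_subst_append]
    constructor
    · rw [Constraint.subst_congr fun x hx => hτD x (.inr (.inl hx))]
      exact hσ.1
    · simp only [Clause.subst, Constraint.subst_subst]
      have : Constraint.subst (fun x => τ (ρ x)) K.constr = Constraint.subst σK K.constr :=
        Constraint.subst_congr fun x hx => hτK x (.inr (.inl hx))
      simp only [Term.subst, this, hK.1]
  · intro B hB
    simp only [Clause.subst, Goal.subst, List.mem_append, List.mem_map] at hB
    rcases hB with (hB | ⟨B, hB, rfl⟩) | hB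
    · rw [hbD B (hLD B hB)]; exact hσ.2 B (hLD B hB)
    · rw [hbK B hB]; exact hK.2 B hB
    · rw [hbD B (hRD B hB)]; exact hσ.2 B (hRD B hB)
  · rw [goalWt_append, goalWt_append, goalWt_congr fun B hB => hbD B (hLD B hB),
      goalWt_congr fun B hB => hbD B (hRD B hB)]
    simp only [Clause.subst, goalWt_subst]
    congr 2
    refine goalWt_congr fun B hB => ?_
    rw [← hbK B hB, Atom.subst_subst]

theorem exists_isResolvent (hD : D.body = L ++ A :: R)
    (hσ : TrueIn P σ D.constr D.body) (hK : TrueIn P σK K.constr K.body)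
    (hA : K.head.subst σK = A.subst σ) : ∃ D', IsResolvent D L A R K D' := by
  obtain ⟨ρ, hd⟩ := K.exists_perm_disjoint D
  obtain ⟨τ, hτD, hτK⟩ := exists_common_valuation hd σ σK
  -- The weight equation is discarded, so any choice of high predicates and weights serves.
  obtain ⟨hu, -, ht, -⟩ := trueIn_variant (High := fun _ => True) (wt := fun _ => 0) hD hσ hK hA
    hτD hτK
  obtain ⟨θ, hθ⟩ := exists_isMGU_of_ground hu
  obtain ⟨ξ, rfl⟩ := hθ.exists_ground hu
  exact ⟨_, ρ, _, θ, rfl, hd, hθ, ⟨ξ, by rw [Constraint.subst_subst]; exact ht.1⟩, rfl⟩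

theorem IsResolvent.complete {D' : Clause F Pr} (h : IsResolvent D L A R K D')
    (hD : D.body = L ++ A :: R) (hσ : TrueIn P σ D.constr D.body)
    (hK : TrueIn P σK K.constr K.body) (hA : K.head.subst σK = A.subst σ) :
    ∃ σ', D'.head.subst σ' = D.head.subst σ ∧ TrueIn P σ' D'.constr D'.body ∧
      goalWt High wt σ' D'.body =
        goalWt High wt σ L + goalWt High wt σK K.body + goalWt High wt σ R := by
  obtain ⟨ρ, K', θ, rfl, hd, hθ, -, rfl⟩ := h
  obtain ⟨τ, hτD, hτK⟩ := exists_common_valuation hd σ σK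
  obtain ⟨hu, hh, ht, hw⟩ := trueIn_variant (High := High) (wt := wt) hD hσ hK hA hτD hτK
  obtain ⟨ξ, rfl⟩ := hθ.exists_ground hu
  refine ⟨ξ, ?_, trueIn_subst.2 ht, ?_⟩
  · simp only [Clause.subst, Atom.subst_subst, hh]
  · exact (goalWt_subst _ _).trans hw

theorem exists_isUnf (P : Program F Pr) (D : Clause F Pr) (L : Goal F Pr ℕ) (A : Atom F Pr ℕ)
    (R : Goal F Pr ℕ) : ∃ S, IsUnf P D L A R S := by
  classical
  refine ⟨_, fun K => if h : ∃ D', IsResolvent D L A R K D' then h.choose else K,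
    fun K _ h => ?_, rfl⟩
  simp only [dif_pos h]
  exact h.choose_spec

theorem IsUnf.exists_isResolvent {S : Finset (Clause F Pr)} (h : IsUnf P D L A R S)
    {E : Clause F Pr} (hE : E ∈ S) : ∃ K ∈ P, IsResolvent D L A R K E := by
  obtain ⟨g, hg, rfl⟩ := h
  simp only [Finset.mem_image, Finset.mem_filter] at hE
  obtain ⟨K, ⟨hK, hex⟩, rfl⟩ := hE
  exact ⟨K, hK, hg K hK hex⟩

theorem DependsOn.of_mem {C : Clause F Pr} (hC : C ∈ P) {B : Atom F Pr ℕ} (hB : B ∈ C.body) :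
    DependsOn P C.head.pred B.pred :=
  Relation.TransGen.single ⟨C, hC, rfl, B, hB, rfl⟩

/-- Resolve `A` with the clause instance that `IsWeight` supplies. If `A` is high, its weight is
replaced by a strictly smaller one. If `A` is low, so is everything in the body that replaces it,
and both sides count as zero. -/
theorem IsUnf.complete {S : Finset (Clause F Pr)} (h : IsUnf P D L A R S)
    (hwt : IsWeight P High wt)
    (hdep : ∀ p q, ¬ High p → High q → ¬ DependsOn P p q)
    (hD : D.body = L ++ A :: R) (hσ : TrueIn P σ D.constr D.body) :
    ∃ E ∈ S, ∃ σ', E.head.subst σ' = D.head.subst σ ∧ TrueIn P σ' E.constr E.body ∧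
      goalWt High wt σ' E.body ≤ goalWt High wt σ D.body ∧
      (High A.pred → goalWt High wt σ' E.body < goalWt High wt σ D.body) := by
  classical
  obtain ⟨K, hKP, σK, hA, hK, hlt⟩ := hwt _ (hσ.2 A (by rw [hD]; simp))
  obtain ⟨g, hg, rfl⟩ := h
  have hex := CLP.exists_isResolvent hD hσ hK hA
  obtain ⟨σ', hh, ht, hw⟩ := (hg K hKP hex).complete (High := High) (wt := wt) hD hσ hK hA
  have hsum : goalWt High wt σ D.body =
      goalWt High wt σ L + (goalWt High wt σ [A] + goalWt High wt σ R) := by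
    rw [hD, ← goalWt_append, ← goalWt_append]; rfl
  refine ⟨g K, Finset.mem_image.2 ⟨K, Finset.mem_filter.2 ⟨hKP, hex⟩, rfl⟩, σ', hh, ht, ?_⟩
  rw [hw, hsum]
  by_cases hH : High A.pred
  · rw [goalWt_singleton_high hH]
    exact ⟨by omega, fun _ => by omega⟩
  · have hp : K.head.pred = A.pred := congrArg (fun B => B.pred) hA
    have : goalWt High wt σK K.body = 0 :=
      goalWt_eq_zero fun B hB hBH => hdep _ _ (hp ▸ hH) hBH (.of_mem hKP hB)
    exact ⟨by omega, fun h => absurd h hH⟩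

end

/-! ### The interpretation of the new predicates -/

/-- The predicate is low or occurs in `P`. -/
def Old (P : Program F Pr) (High : Pr → Prop) (p : Pr) : Prop := ¬ High p ∨ Occurs P p

/-- The assumptions on the input program `P` and its clause `C₀` for the initial predicate. -/
structure IsInput (P : Program F Pr) (High : Pr → Prop) (C₀ : Clause F Pr) : Prop where
  mem : C₀ ∈ P
  unique : ∀ C ∈ P, C.head.pred = C₀.head.pred → C = C₀
  high : High C₀.head.pred
  exists_high : ∃ B ∈ C₀.body, High B.pred
  dep : ∀ p q, ¬ High p → High q → ¬ DependsOn P p q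

/-- The properties of the sets of definitions constructed by the strategy. -/
structure IsDefs (P : Program F Pr) (High : Pr → Prop) (C₀ : Clause F Pr)
    (Δ : Finset (Clause F Pr)) : Prop where
  mem : C₀ ∈ Δ
  high : ∀ D ∈ Δ, High D.head.pred
  exists_high : ∀ D ∈ Δ, ∃ B ∈ D.body, High B.pred
  old : ∀ D ∈ Δ, ∀ B ∈ D.body, Old P High B.pred
  new : ∀ D ∈ Δ, D = C₀ ∨ ¬ Occurs P D.head.pred
  inj : ∀ D ∈ Δ, ∀ D' ∈ Δ, D.head.pred = D'.head.pred → D = D'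

/-- The predicate is defined by a clause of `Δ`. -/
def Defined (Δ : Finset (Clause F Pr)) (p : Pr) : Prop := ∃ D ∈ Δ, D.head.pred = p

/-- The least model of `P`, in which the predicates defined by `Δ` are interpreted by means of
their definitions. -/
def defModel (P : Program F Pr) (Δ : Finset (Clause F Pr)) : Set (Atom F Pr Empty) :=
  {A | (A ∈ leastModel P ∧ ¬ Defined Δ A.pred) ∨
    ∃ D ∈ Δ, ∃ σ, D.head.subst σ = A ∧ TrueIn P σ D.constr D.body}

open Classical in
/-- The weight function for `defModel P Δ` determined by the weight function `wt` for `P`. -/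
noncomputable def defWt (P : Program F Pr) (High : Pr → Prop) (Δ : Finset (Clause F Pr))
    (wt : Atom F Pr Empty → ℕ) (A : Atom F Pr Empty) : ℕ :=
  if Defined Δ A.pred then
    sInf {n | ∃ D ∈ Δ, ∃ σ, D.head.subst σ = A ∧ TrueIn P σ D.constr D.body ∧
      goalWt High wt σ D.body = n}
  else wt A

theorem occurs_of_mem_body {P : Program F Pr} {C : Clause F Pr} (hC : C ∈ P) {B : Atom F Pr ℕ}
    (hB : B ∈ C.body) : Occurs P B.pred := ⟨C, hC, .inr ⟨B, hB, rfl⟩⟩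

theorem occurs_head {P : Program F Pr} {C : Clause F Pr} (hC : C ∈ P) : Occurs P C.head.pred :=
  ⟨C, hC, .inl rfl⟩

section

variable {P : Program F Pr} {High : Pr → Prop} {C₀ : Clause F Pr} {Δ : Finset (Clause F Pr)}
  {wt : Atom F Pr Empty → ℕ} {A : Atom F Pr Empty}

theorem IsDefs.eq_of_old (hΔ : IsDefs P High C₀ Δ) {D : Clause F Pr} (hD : D ∈ Δ)
    (h : Old P High D.head.pred) : D = C₀ :=
  (hΔ.new D hD).resolve_right fun h' => h.elim (absurd (hΔ.high D hD)) h'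

theorem IsInput.exists_of_mem_leastModel (hP : IsInput P High C₀) (hwt : IsWeight P High wt)
    (hA : A ∈ leastModel P) (hp : C₀.head.pred = A.pred) :
    ∃ σ, C₀.head.subst σ = A ∧ TrueIn P σ C₀.constr C₀.body ∧
      goalWt High wt σ C₀.body < wt A := by
  obtain ⟨C, hC, σ, rfl, h⟩ := hwt A hA
  obtain rfl := hP.unique C hC hp.symm
  exact ⟨σ, rfl, h⟩

/-- The only old predicate that `Δ` can define is that of C₀. There the definition agrees with M(P),
because C₀ is the sole clause of P for it. -/
theorem mem_defModel_iff_of_old (hP : IsInput P High C₀) (hΔ : IsDefs P High C₀ Δ)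
    (hA : Old P High A.pred) : A ∈ defModel P Δ ↔ A ∈ leastModel P := by
  constructor
  · rintro (h | ⟨D, hD, σ, rfl, hσ⟩)
    · exact h.1
    · obtain rfl := hΔ.eq_of_old hD hA
      exact leastModel_isModel P D hP.mem σ hσ.1 hσ.2
  · intro h
    by_cases hd : Defined Δ A.pred
    · obtain ⟨D, hD, hp⟩ := hd
      obtain rfl := hΔ.eq_of_old hD (hp ▸ hA)
      obtain ⟨wt, hwt⟩ := exists_weight P High
      obtain ⟨σ, h₁, h₂, -⟩ := hP.exists_of_mem_leastModel hwt h hp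
      exact .inr ⟨D, hD, σ, h₁, h₂⟩
    · exact .inl ⟨h, hd⟩

theorem exists_of_mem_defModel (h : A ∈ defModel P Δ) (hd : Defined Δ A.pred) :
    ∃ D ∈ Δ, ∃ σ, D.head.subst σ = A ∧ TrueIn P σ D.constr D.body :=
  h.resolve_left fun h' => h'.2 hd

theorem defWt_of_not_defined (h : ¬ Defined Δ A.pred) : defWt P High Δ wt A = wt A := if_neg h

theorem defWt_head_le {D : Clause F Pr} (hD : D ∈ Δ) {σ : ℕ → Ground F}
    (hσ : TrueIn P σ D.constr D.body) :
    defWt P High Δ wt (D.head.subst σ) ≤ goalWt High wt σ D.body := by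
  rw [defWt, if_pos ⟨D, hD, rfl⟩]
  exact Nat.sInf_le ⟨D, hD, σ, rfl, hσ, rfl⟩

theorem exists_goalWt_eq_defWt (h : A ∈ defModel P Δ) (hd : Defined Δ A.pred) :
    ∃ D ∈ Δ, ∃ σ, D.head.subst σ = A ∧ TrueIn P σ D.constr D.body ∧
      goalWt High wt σ D.body = defWt P High Δ wt A := by
  rw [defWt, if_pos hd]
  obtain ⟨D, hD, σ, h₁, h₂⟩ := exists_of_mem_defModel h hd
  exact Nat.sInf_mem (s := {n | ∃ D ∈ Δ, ∃ σ, D.head.subst σ = A ∧ TrueIn P σ D.constr D.body ∧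
      goalWt High wt σ D.body = n}) ⟨_, D, hD, σ, h₁, h₂, rfl⟩

/-- The inequality can be strict only for the predicate of C₀: it is both old and defined, and its
definition weight is that of a body, hence less than the weight of the head. -/
theorem defWt_le (hP : IsInput P High C₀) (hwt : IsWeight P High wt) (hΔ : IsDefs P High C₀ Δ)
    (hA : A ∈ leastModel P) (ho : Old P High A.pred) : defWt P High Δ wt A ≤ wt A := by
  by_cases hd : Defined Δ A.pred
  · obtain ⟨D, hD, hp⟩ := hd
    obtain rfl := hΔ.eq_of_old hD (hp ▸ ho)
    obtain ⟨σ, rfl, h₁, h₂⟩ := hP.exists_of_mem_leastModel hwt hA hp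
    exact (defWt_head_le hD h₁).trans h₂.le
  · exact (defWt_of_not_defined hd).le

/-! ### Soundness and completeness of sets of clauses -/

/-- Truth of the body of `E` in `defModel P Δ`. -/
def TrueInDefs (P : Program F Pr) (Δ : Finset (Clause F Pr)) (σ : ℕ → Ground F)
    (E : Clause F Pr) : Prop :=
  (Constraint.subst σ E.constr).Holds ∧ ∀ B ∈ E.body, B.subst σ ∈ defModel P Δ

/-- The clause, with body interpreted in the least model of `P`, derives only true atoms. -/
def Sound (P : Program F Pr) (Δ : Finset (Clause F Pr)) (E : Clause F Pr) : Prop :=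
  ∀ σ, TrueIn P σ E.constr E.body → E.head.subst σ ∈ defModel P Δ

/-- The clause is true in `defModel P Δ`. -/
def SoundDefs (P : Program F Pr) (Δ : Finset (Clause F Pr)) (E : Clause F Pr) : Prop :=
  ∀ σ, TrueInDefs P Δ σ E → E.head.subst σ ∈ defModel P Δ

/-- Whatever can be derived by `C` can be derived by a clause of `T`, from a lighter body. -/
def Covers (P : Program F Pr) (High : Pr → Prop) (wt : Atom F Pr Empty → ℕ)
    (T : Finset (Clause F Pr)) (C : Clause F Pr) : Prop :=
  ∀ σ, TrueIn P σ C.constr C.body → ∃ E ∈ T, ∃ σ', E.head.subst σ' = C.head.subst σ ∧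
    TrueIn P σ' E.constr E.body ∧ goalWt High wt σ' E.body < goalWt High wt σ C.body

/-- The same, with bodies of `T` interpreted in `defModel P Δ`. -/
def CoversDefs (P : Program F Pr) (High : Pr → Prop) (Δ : Finset (Clause F Pr))
    (wt : Atom F Pr Empty → ℕ) (T : Finset (Clause F Pr)) (C : Clause F Pr) : Prop :=
  ∀ σ, TrueIn P σ C.constr C.body → ∃ E ∈ T, ∃ σ', E.head.subst σ' = C.head.subst σ ∧
    TrueInDefs P Δ σ' E ∧
      goalWt High (defWt P High Δ wt) σ' E.body < goalWt High wt σ C.body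

theorem trueInDefs_iff_of_old (hP : IsInput P High C₀) (hΔ : IsDefs P High C₀ Δ)
    {E : Clause F Pr} (hE : ∀ B ∈ E.body, Old P High B.pred) {σ : ℕ → Ground F} :
    TrueInDefs P Δ σ E ↔ TrueIn P σ E.constr E.body :=
  and_congr_right' (forall₂_congr fun B hB => mem_defModel_iff_of_old hP hΔ (hE B hB))

/-- The passage from M(P) to `defModel P Δ`, made just before folding, while all body predicates are
still old: truth is the same and weights can only drop. -/
theorem Covers.coversDefs (hP : IsInput P High C₀) (hwt : IsWeight P High wt)
    (hΔ : IsDefs P High C₀ Δ) {T : Finset (Clause F Pr)} {C : Clause F Pr}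
    (h : Covers P High wt T C) (hT : ∀ E ∈ T, ∀ B ∈ E.body, Old P High B.pred) :
    CoversDefs P High Δ wt T C := by
  intro σ hσ
  obtain ⟨E, hE, σ', h₁, h₂, h₃⟩ := h σ hσ
  exact ⟨E, hE, σ', h₁, (trueInDefs_iff_of_old hP hΔ (hT E hE)).2 h₂,
    (goalWt_le_goalWt fun B hB _ => defWt_le hP hwt hΔ (h₂.2 B hB) (hT E hE B hB)).trans_lt h₃⟩

theorem Covers.of_forall {T T' : Finset (Clause F Pr)} {C : Clause F Pr}
    (h : Covers P High wt T C)
    (hT : ∀ E ∈ T, ∀ σ, TrueIn P σ E.constr E.body → ∃ E' ∈ T', ∃ σ',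
      E'.head.subst σ' = E.head.subst σ ∧ TrueIn P σ' E'.constr E'.body ∧
        goalWt High wt σ' E'.body ≤ goalWt High wt σ E.body) :
    Covers P High wt T' C := by
  intro σ hσ
  obtain ⟨E, hE, σ', h₁, h₂, h₃⟩ := h σ hσ
  obtain ⟨E', hE', τ, h₄, h₅, h₆⟩ := hT E hE σ' h₂
  exact ⟨E', hE', τ, h₄.trans h₁, h₅, h₆.trans_lt h₃⟩

/-! ### Correctness of goal replacement and folding -/

section Replacement

variable {D : Clause F Pr} {S : Finset (Clause F Pr)}

theorem IsReplacement.old (h : IsReplacement P High D S)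
    (hD : ∀ B ∈ D.body, Old P High B.pred) : ∀ E ∈ S, ∀ B ∈ E.body, Old P High B.pred := by
  obtain ⟨c₁, c, L, G₁, R, alts, -, hb, -, halts, -, rfl⟩ := h
  intro E hE B hB
  simp only [List.mem_toFinset, List.mem_map] at hE
  obtain ⟨a, ha, rfl⟩ := hE
  simp only [List.mem_append] at hB
  rcases hB with (hB | hB) | hB
  · exact hD B (hb.mem_iff.2 (by simp [hB]))
  · exact .inl (halts a ha B hB)
  · exact hD B (hb.mem_iff.2 (by simp [hB]))

theorem IsReplacement.sound (h : IsReplacement P High D S) (hD : Sound P Δ D) :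
    ∀ E ∈ S, Sound P Δ E := by
  obtain ⟨c₁, c, L, G₁, R, alts, hc, hb, -, -, hiff, rfl⟩ := h
  intro E hE σ hσ
  simp only [List.mem_toFinset, List.mem_map] at hE
  obtain ⟨a, ha, rfl⟩ := hE
  obtain ⟨h₁, h₂⟩ := hσ
  rw [Constraint.holds_subst_append] at h₁
  simp only [List.mem_append] at h₂
  have ht := (hiff σ).2 ⟨a, ha, h₁.1, fun B hB => h₂ B (.inl (.inr hB))⟩
  refine hD σ ⟨(Constraint.holds_subst_perm hc).2
    ((Constraint.holds_subst_append _ _ _).2 ⟨ht.1, h₁.2⟩), fun B hB => ?_⟩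
  rw [hb.mem_iff, List.mem_append, List.mem_append] at hB
  rcases hB with (hB | hB) | hB
  · exact h₂ B (.inl (.inl hB))
  · exact ht.2 B hB
  · exact h₂ B (.inr hB)

/-- The equivalence holds for each valuation of all variables, so the valuation need not change.
Only low atoms are exchanged, and these have weight zero. -/
theorem IsReplacement.complete (h : IsReplacement P High D S) {σ : ℕ → Ground F}
    (hσ : TrueIn P σ D.constr D.body) :
    ∃ E ∈ S, E.head = D.head ∧ TrueIn P σ E.constr E.body ∧
      goalWt High wt σ E.body = goalWt High wt σ D.body := by
  obtain ⟨c₁, c, L, G₁, R, alts, hc, hb, hlow, halts, hiff, rfl⟩ := h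
  obtain ⟨h₁, h₂⟩ := hσ
  rw [Constraint.holds_subst_perm hc, Constraint.holds_subst_append] at h₁
  simp only [hb.mem_iff, List.mem_append] at h₂
  obtain ⟨a, ha, ht⟩ := (hiff σ).1 ⟨h₁.1, fun B hB => h₂ B (.inl (.inr hB))⟩
  refine ⟨_, List.mem_toFinset.2 (List.mem_map_of_mem ha), rfl,
    ⟨(Constraint.holds_subst_append _ _ _).2 ⟨ht.1, h₁.2⟩, fun B hB => ?_⟩, ?_⟩
  · simp only [List.mem_append] at hB
    rcases hB with (hB | hB) | hB
    · exact h₂ B (.inl (.inl hB))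
    · exact ht.2 B hB
    · exact h₂ B (.inr hB)
  · simp only [goalWt_perm hb, goalWt_append, goalWt_eq_zero hlow, goalWt_eq_zero (halts a ha)]

end Replacement

section Folding

variable {E D : Clause F Pr} {L Q R : Goal F Pr ℕ} {θ : ℕ → Term F ℕ}

/-- A valuation of the variables of `E` and a valuation of those of `D` that agree on the
instance of the head of `D` used for folding can be combined. -/
theorem CanFold.exists_valuation (h : CanFold E L Q R D θ) {σ σ' : ℕ → Ground F}
    (hh : D.head.subst σ' = (D.head.subst θ).subst σ) :
    ∃ τ : ℕ → Ground F,
      (∀ y ∈ E.head.vars ∪ Constraint.vars E.constr ∪ Goal.vars L ∪ Goal.vars R, τ y = σ y) ∧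
      ∀ z ∈ D.bodyVars, (θ z).subst τ = σ' z := by
  classical
  obtain ⟨-, -, hvar⟩ := h
  rw [Atom.subst_subst] at hh
  -- `y` is the image of an existential variable `x` of `D`. Such `y` may be revalued by `σ'`
  -- freely: condition (c) keeps them out of the rest of `E` and out of the images of the other
  -- variables.
  let IsLocal : ℕ → ℕ → Prop := fun y x => x ∈ D.bodyVars ∧ x ∉ D.head.vars ∧ θ x = .var y
  have hloc : ∀ {y x}, IsLocal y x →
      y ∉ E.head.vars ∪ Constraint.vars E.constr ∪ Goal.vars L ∪ Goal.vars R ∧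
      ∀ z ∈ D.vars, z ≠ x → y ∉ (θ z).vars := by
    rintro y x ⟨h₁, h₂, h₃⟩
    obtain ⟨y', hy', h₄⟩ := hvar x h₁ h₂
    obtain rfl : y' = y := Term.var.inj (hy'.symm.trans h₃)
    exact h₄
  let τ : ℕ → Ground F := fun y => if h : ∃ x, IsLocal y x then σ' h.choose else σ y
  have hτ : ∀ {y}, (¬ ∃ x, IsLocal y x) → τ y = σ y := fun h => dif_neg h
  refine ⟨τ, fun y hy => hτ fun ⟨x, hx⟩ => (hloc hx).1 hy, fun z hz => ?_⟩
  by_cases hzh : z ∈ D.head.vars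
  · rw [Atom.eq_of_subst_eq hh z hzh]
    refine Term.subst_congr fun y hy => hτ fun ⟨x, hx⟩ => ?_
    exact (hloc hx).2 z (.inl hzh) (by rintro rfl; exact hx.2.1 hzh) hy
  · obtain ⟨y, hy, -⟩ := hvar z hz hzh
    have hex : ∃ x, IsLocal y x := ⟨z, hz, hzh, hy⟩
    -- Distinct existential variables have distinct images, so the choice made in `τ` is
    -- unambiguous.
    have hc : hex.choose = z := by
      by_contra hne
      exact (hloc hex.choose_spec).2 z (.inr hz) (Ne.symm hne) (by rw [hy]; rfl)
    rw [hy]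
    calc τ y = σ' hex.choose := dif_pos hex
      _ = σ' z := by rw [hc]

/-- Folding can be undone: a head predicate has only one definition in `Δ`, so truth of the instance
of the head of `D` provides values for the existential variables that make `Q` true. Condition (c)
allows them to be joined with the valuation of the rest of `E`. -/
theorem CanFold.soundDefs (hP : IsInput P High C₀) (hΔ : IsDefs P High C₀ Δ) (hD : D ∈ Δ)
    (hb : E.body.Perm (L ++ Q ++ R)) (h : CanFold E L Q R D θ)
    (hQ : ∀ B ∈ Q, Old P High B.pred) (hE : SoundDefs P Δ E) :
    SoundDefs P Δ (folded E L R D θ) := by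
  rintro σ ⟨hσc, hσb⟩
  simp only [folded, List.mem_append, List.mem_cons] at hσc hσb
  obtain ⟨D', hD', σ', hh, hσ'⟩ :=
    exists_of_mem_defModel (hσb _ (.inr (.inl rfl))) ⟨D, hD, rfl⟩
  obtain rfl := hΔ.inj D' hD' D hD (congrArg (fun A => A.pred) hh)
  obtain ⟨τ, hτ, hτD⟩ := h.exists_valuation hh
  have hhead : E.head.subst τ = E.head.subst σ :=
    Atom.subst_congr fun y hy => hτ y (.inl (.inl (.inl hy)))
  change E.head.subst σ ∈ _
  rw [← hhead]
  refine hE τ ⟨?_, fun B hB => ?_⟩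
  · rwa [Constraint.subst_congr fun y hy => hτ y (.inl (.inl (.inr hy)))]
  · rw [hb.mem_iff, List.mem_append, List.mem_append] at hB
    rcases hB with (hB | hB) | hB
    · rw [Atom.subst_congr fun y hy => hτ y (.inl (.inr ⟨B, hB, hy⟩))]
      exact hσb B (.inl hB)
    · refine (mem_defModel_iff_of_old hP hΔ (by exact hQ B hB)).2 ?_
      rw [h.1] at hB
      obtain ⟨B', hB', rfl⟩ := List.mem_map.1 hB
      rw [Atom.subst_subst, Atom.subst_congr fun z hz => hτD z (.inr ⟨B', hB', hz⟩)]
      exact hσ'.2 B' hB'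
    · rw [Atom.subst_congr fun y hy => hτ y (.inr ⟨B, hB, hy⟩)]
      exact hσb B (.inr (.inr hB))

/-- The folded atom weighs at most the particular true body instance `Q`, by minimality of `defWt`.
That `Q` contains no defined predicate is essential: only then do `wt` and `defWt` agree on it,
whereas for the predicate of C₀ `defWt` may be smaller. -/
theorem CanFold.complete (hP : IsInput P High C₀) (hΔ : IsDefs P High C₀ Δ) (hD : D ∈ Δ)
    (hb : E.body.Perm (L ++ Q ++ R)) (h : CanFold E L Q R D θ)
    (hQ : ∀ B ∈ Q, Old P High B.pred) (hQd : ∀ B ∈ Q, ¬ Defined Δ B.pred)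
    {σ : ℕ → Ground F} (hσ : TrueInDefs P Δ σ E) :
    TrueInDefs P Δ σ (folded E L R D θ) ∧
      goalWt High (defWt P High Δ wt) σ (folded E L R D θ).body ≤
        goalWt High (defWt P High Δ wt) σ E.body := by
  obtain ⟨hc, hbody⟩ := hσ
  simp only [hb.mem_iff, List.mem_append] at hbody
  have hDt : TrueIn P (fun x => (θ x).subst σ) D.constr D.body := by
    rw [← trueIn_subst]
    refine ⟨h.2.1 σ hc, fun B hB => ?_⟩
    rw [← h.1] at hB
    exact (mem_defModel_iff_of_old hP hΔ (by exact hQ B hB)).1 (hbody B (.inl (.inr hB)))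
  refine ⟨⟨hc, fun B hB => ?_⟩, ?_⟩
  · simp only [folded, List.mem_append, List.mem_cons] at hB
    rcases hB with hB | rfl | hB
    · exact hbody B (.inl (.inl hB))
    · exact .inr ⟨D, hD, _, (Atom.subst_subst _ _ _).symm, hDt⟩
    · exact hbody B (.inr hB)
  · have hN : (folded E L R D θ).body = L ++ [D.head.subst θ] ++ R := by simp [folded]
    rw [goalWt_perm hb, hN]
    simp only [goalWt_append]
    have hQw : goalWt High wt (fun x => (θ x).subst σ) D.body ≤
        goalWt High (defWt P High Δ wt) σ Q := by
      rw [← goalWt_subst, ← h.1]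
      exact goalWt_le_goalWt fun B hB _ => (defWt_of_not_defined (hQd B hB)).ge
    have hNw := defWt_head_le (High := High) (wt := wt) hD hDt
    rw [← Atom.subst_subst, ← goalWt_singleton_high (High := High)
      (wt := defWt P High Δ wt) (B := D.head.subst θ) (hΔ.high D hD)] at hNw
    omega

end Folding

end

/-! ### Useless predicates -/

section Useless

variable {X : Program F Pr} {A : Atom F Pr Empty}

/-- True atoms with predicates that are not useless form a model: a clause for a useless predicate
has a useless body atom, so it never fires in this set. -/
theorem not_useless_of_mem_leastModel (hA : A ∈ leastModel X) : ¬ Useless X A.pred := by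
  have h : IsModel X {A | A ∈ leastModel X ∧ ¬ Useless X A.pred} := by
    refine fun C hC σ hc hb =>
      ⟨leastModel_isModel X C hC σ hc fun B hB => (hb B hB).1, fun ⟨U, hU, hp⟩ => ?_⟩
    obtain ⟨B, hB, hBU⟩ := ((hU _).1 hp).2 C hC rfl
    exact (hb B hB).2 ⟨U, hU, hBU⟩
  exact (leastModel_subset h hA).2

theorem leastModel_mono {X Y : Program F Pr} (h : X ⊆ Y) : leastModel X ⊆ leastModel Y :=
  leastModel_subset fun C hC => leastModel_isModel Y C (h hC)

theorem mem_removeUseless {C : Clause F Pr} :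
    C ∈ removeUseless X ↔ C ∈ X ∧ ¬ Useless X C.head.pred := by
  simp only [removeUseless, Finset.mem_filter]

theorem mem_lowClauses {High : Pr → Prop} {C : Clause F Pr} :
    C ∈ lowClauses High X ↔ C ∈ X ∧ ¬ High C.head.pred := by
  simp only [lowClauses, Finset.mem_filter]

theorem leastModel_removeUseless (X : Program F Pr) :
    leastModel (removeUseless X) = leastModel X := by
  have hsub : removeUseless X ⊆ X := fun C hC => (mem_removeUseless.1 hC).1
  refine (leastModel_mono hsub).antisymm (leastModel_subset fun C hC σ hc hb => ?_)
  have hX : C.head.subst σ ∈ leastModel X :=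
    leastModel_isModel X C hC σ hc fun B hB => leastModel_mono hsub (hb B hB)
  exact leastModel_isModel _ C (mem_removeUseless.2 ⟨hC, not_useless_of_mem_leastModel hX⟩)
    σ hc hb

end Useless

section

variable {P : Program F Pr} {High : Pr → Prop} {C₀ : Clause F Pr} {sel : Selection F Pr}
  {Gen : GenOp F Pr} {Δ : Finset (Clause F Pr)} {wt : Atom F Pr Empty → ℕ} {s s' : State F Pr}

/-! ### Invariants of the definitions and of the predicates in bodies -/

/-- The predicates in the bodies of the clauses under construction. -/
def PhaseInv (P : Program F Pr) (High : Pr → Prop) (I Δ : Finset (Clause F Pr)) :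
    Phase F Pr → Prop
  | .unfolding C T => C ∈ I ∧ ∀ D ∈ T, ∀ B ∈ D.clause.body, Old P High B.pred
  | .replacing C T => C ∈ I ∧ ∀ E ∈ T, ∀ B ∈ E.body, Old P High B.pred
  | .removing C T => C ∈ I ∧ ∀ E ∈ T, ∀ B ∈ E.body, Old P High B.pred
  | .folding C T => C ∈ I ∧ ∀ E ∈ T, ∀ B ∈ E.body, Old P High B.pred ∨ Defined Δ B.pred
  | _ => True

structure DefsInv (P : Program F Pr) (High : Pr → Prop) (C₀ : Clause F Pr) (s : State F Pr) :
    Prop where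
  defs : IsDefs P High C₀ s.defs
  sub : s.inDefs ⊆ s.defs
  phase : PhaseInv P High s.inDefs s.defs s.phase

theorem IsResolvent.old {D K D' : Clause F Pr} {L R : Goal F Pr ℕ} {A : Atom F Pr ℕ}
    (h : IsResolvent D L A R K D') (hK : K ∈ P) (hD : D.body = L ++ A :: R)
    (ho : ∀ B ∈ D.body, Old P High B.pred) : ∀ B ∈ D'.body, Old P High B.pred := by
  obtain ⟨ρ, K', θ, rfl, -, -, -, rfl⟩ := h
  intro B' hB'
  obtain ⟨B, hB, rfl⟩ := List.mem_map.1 hB'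
  rw [List.mem_append, List.mem_append] at hB
  rcases hB with (hB | hB) | hB
  · exact ho B (by simp [hD, hB])
  · obtain ⟨B₁, hB₁, rfl⟩ := List.mem_map.1 hB
    have h := occurs_of_mem_body hK hB₁
    exact .inr h
  · exact ho B (by simp [hD, hB])

theorem ToFold.old {E : Clause F Pr} {L Q R : Goal F Pr ℕ} (h : ToFold High Δ E L Q R)
    (hE : ∀ B ∈ E.body, Old P High B.pred ∨ Defined Δ B.pred) : ∀ B ∈ Q, Old P High B.pred :=
  fun B hB => (hE B (h.1.mem_iff.2 (by simp [hB]))).resolve_right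
    fun ⟨D, hD, hp⟩ => h.2.2 B hB D hD hp

/-- The predicates of a goal to be folded will never be defined. -/
theorem ToFold.not_defined {Δ' : Finset (Clause F Pr)} {E : Clause F Pr} {L Q R : Goal F Pr ℕ}
    (h : ToFold High Δ E L Q R) (hC₀ : C₀ ∈ Δ) (hΔ' : IsDefs P High C₀ Δ')
    (hQ : ∀ B ∈ Q, Old P High B.pred) : ∀ B ∈ Q, ¬ Defined Δ' B.pred := by
  rintro B hB ⟨D, hD, hp⟩
  obtain rfl := hΔ'.eq_of_old hD (hp ▸ hQ B hB)
  exact h.2.2 B hB D hC₀ hp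

theorem IsDefs.insert_new (hΔ : IsDefs P High C₀ Δ) {D : Clause F Pr} (hh : High D.head.pred)
    (hex : ∃ B ∈ D.body, High B.pred) (ho : ∀ B ∈ D.body, Old P High B.pred)
    (hn : ¬ Occurs (P ∪ Δ) D.head.pred) : IsDefs P High C₀ (Δ ∪ {D}) := by
  have hnP : ¬ Occurs P D.head.pred := fun ⟨C, hC, h⟩ => hn ⟨C, Finset.mem_union_left _ hC, h⟩
  have hnΔ : ∀ D' ∈ Δ, D'.head.pred ≠ D.head.pred := fun D' hD' h =>
    hn ⟨D', Finset.mem_union_right _ hD', .inl h⟩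
  have hm : ∀ {D'}, D' ∈ Δ ∪ {D} → D' ∈ Δ ∨ D' = D := fun h => by
    simpa only [Finset.mem_union, Finset.mem_singleton] using h
  refine ⟨Finset.mem_union_left _ hΔ.mem, fun D' h => ?_, fun D' h => ?_, fun D' h => ?_,
    fun D' h => ?_, fun D₁ h₁ D₂ h₂ hp => ?_⟩
  · rcases hm h with h | rfl
    exacts [hΔ.high D' h, hh]
  · rcases hm h with h | rfl
    exacts [hΔ.exists_high D' h, hex]
  · rcases hm h with h | rfl
    exacts [hΔ.old D' h, ho]
  · rcases hm h with h | rfl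
    exacts [hΔ.new D' h, .inr hnP]
  · rcases hm h₁ with h₁' | e₁ <;> rcases hm h₂ with h₂' | e₂
    · exact hΔ.inj D₁ h₁' D₂ h₂' hp
    · exact absurd (e₂ ▸ hp) (hnΔ _ h₁')
    · exact absurd (e₁ ▸ hp.symm) (hnΔ _ h₂')
    · exact e₁.trans e₂.symm

theorem Defined.mono {Δ' : Finset (Clause F Pr)} (h : Δ ⊆ Δ') {p : Pr} :
    Defined Δ p → Defined Δ' p := fun ⟨D, hD, hp⟩ => ⟨D, h hD, hp⟩

theorem folded_body_old_or_defined {Δ' : Finset (Clause F Pr)} {E D : Clause F Pr}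
    {L Q R : Goal F Pr ℕ} {θ : ℕ → Term F ℕ} (hb : E.body.Perm (L ++ Q ++ R)) (hD : D ∈ Δ')
    (hs : Δ ⊆ Δ') (hE : ∀ B ∈ E.body, Old P High B.pred ∨ Defined Δ B.pred) :
    ∀ B ∈ (folded E L R D θ).body, Old P High B.pred ∨ Defined Δ' B.pred := by
  intro B hB
  simp only [folded, List.mem_append, List.mem_cons] at hB
  rcases hB with hB | rfl | hB
  · exact (hE B (hb.mem_iff.2 (by simp [hB]))).imp_right (.mono hs)
  · exact .inr ⟨D, hD, rfl⟩
  · exact (hE B (hb.mem_iff.2 (by simp [hB]))).imp_right (.mono hs)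

theorem IsInput.defsInv_init (hP : IsInput P High C₀) :
    DefsInv P High C₀ (State.init P High C₀) := by
  refine ⟨⟨Finset.mem_singleton_self _, ?_, ?_, ?_, ?_, ?_⟩, subset_rfl, trivial⟩ <;>
    simp only [State.init, Finset.mem_singleton, forall_eq]
  · exact hP.high
  · exact hP.exists_high
  · exact fun B hB => .inr (occurs_of_mem_body hP.mem hB)
  · exact .inl trivial
  · exact fun _ => trivial

theorem DefsInv.step (hGen : IsGenOp P High Gen) (hs : Step P High sel Gen s s')
    (h : DefsInv P High C₀ s) : DefsInv P High C₀ s' := by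
  obtain ⟨hd, hsub, hph⟩ := h
  cases hs with
  | start mem split high leftmost unf =>
    refine ⟨hd, hsub, mem, fun D hD => ?_⟩
    obtain ⟨E, hE, rfl⟩ := Finset.mem_image.1 hD
    obtain ⟨K, hK, hr⟩ := unf.exists_isResolvent hE
    exact hr.old hK split (hd.old _ (hsub mem))
  | unfold mem split unfoldable unf =>
    refine ⟨hd, hsub, hph.1, fun D hD => ?_⟩
    rcases Finset.mem_union.1 hD with hD | hD
    · exact hph.2 D (Finset.mem_of_mem_erase hD)
    · obtain ⟨E, hE, rfl⟩ := Finset.mem_image.1 hD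
      obtain ⟨K, hK, hr⟩ := unf.exists_isResolvent hE
      exact hr.old hK split (hph.2 _ mem)
  | unfoldEnd none =>
    refine ⟨hd, hsub, hph.1, fun E hE => ?_⟩
    obtain ⟨D, hD, rfl⟩ := Finset.mem_image.1 hE
    exact hph.2 D hD
  | replace repl =>
    obtain ⟨f, hf, rfl⟩ := repl
    refine ⟨hd, hsub, hph.1, fun E hE => ?_⟩
    obtain ⟨D, hD, hE⟩ := Finset.mem_biUnion.1 hE
    rcases hf D hD with h | h
    · rw [h, Finset.mem_singleton] at hE
      exact hE ▸ hph.2 D hD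
    · exact h.old (hph.2 D hD) E hE
  | remove mem unsat =>
    exact ⟨hd, hsub, hph.1, fun E hE => hph.2 E (Finset.mem_of_mem_erase hE)⟩
  | removeEnd none => exact ⟨hd, hsub, hph.1, fun E hE B hB => .inl (hph.2 E hE B hB)⟩
  | fold mem toFold memD canFold =>
    refine ⟨hd, hsub, hph.1, fun E hE => ?_⟩
    rcases Finset.mem_union.1 hE with hE | hE
    · exact hph.2 E (Finset.mem_of_mem_erase hE)
    · rw [Finset.mem_singleton.1 hE]
      exact folded_body_old_or_defined toFold.1 memD subset_rfl (hph.2 _ mem)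
  | @define X I Δ T C E L Q R θ mem toFold none canFold =>
    obtain ⟨hh, hn, -⟩ := hGen E L Q R Δ toFold none
    have hQ := toFold.old (hph.2 _ mem)
    have hpred : ∀ B ∈ (Gen E Q Δ).body, ∃ B' ∈ Q, B'.pred = B.pred := fun B hB =>
      ⟨B.subst θ, by rw [canFold.1]; exact List.mem_map_of_mem hB, rfl⟩
    refine ⟨hd.insert_new hh ?_ (fun B hB => ?_) hn, Finset.union_subset_union_left hsub,
      Finset.mem_union_left _ hph.1, fun E' hE' => ?_⟩
    · obtain ⟨B, hB, hBh⟩ := toFold.2.1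
      rw [canFold.1] at hB
      obtain ⟨B', hB', rfl⟩ := List.mem_map.1 hB
      exact ⟨B', hB', hBh⟩
    · obtain ⟨B', hB', hp⟩ := hpred B hB
      exact hp ▸ hQ B' hB'
    · rcases Finset.mem_union.1 hE' with hE' | hE'
      · exact fun B hB => (hph.2 E' (Finset.mem_of_mem_erase hE') B hB).imp_right
          (.mono Finset.subset_union_left)
      · rw [Finset.mem_singleton.1 hE']
        exact folded_body_old_or_defined toFold.1 (by simp) Finset.subset_union_left
          (hph.2 _ mem)
  | foldEnd none => exact ⟨hd, (Finset.erase_subset _ _).trans hsub, trivial⟩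
  | halt => exact ⟨hd, Finset.empty_subset _, trivial⟩

theorem IsInput.defsInv (hP : IsInput P High C₀) (hGen : IsGenOp P High Gen)
    (hs : Reachable P High sel Gen (State.init P High C₀) s) : DefsInv P High C₀ s := by
  induction hs with
  | refl => exact hP.defsInv_init
  | tail _ hstep ih => exact ih.step hGen hstep

theorem Step.defs_subset (hs : Step P High sel Gen s s') : s.defs ⊆ s'.defs := by
  cases hs with
  | define => exact Finset.subset_union_left
  | _ => exact subset_rfl

/-! ### Invariants of the meaning of the clauses -/

/-- Correctness of the clauses under construction, with respect to the final definitions `Δ`. -/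
def PhaseCorrect (P : Program F Pr) (High : Pr → Prop) (Δ : Finset (Clause F Pr))
    (wt : Atom F Pr Empty → ℕ) : Phase F Pr → Prop
  | .unfolding C T => (∀ D ∈ T, Sound P Δ D.clause) ∧
      Covers P High wt (T.image Derived.clause) C
  | .replacing C T => (∀ E ∈ T, Sound P Δ E) ∧ Covers P High wt T C
  | .removing C T => (∀ E ∈ T, Sound P Δ E) ∧ Covers P High wt T C
  | .folding C T => (∀ E ∈ T, SoundDefs P Δ E) ∧ CoversDefs P High Δ wt T C
  | _ => True

structure CorrectInv (P : Program F Pr) (High : Pr → Prop) (Δ : Finset (Clause F Pr))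
    (wt : Atom F Pr Empty → ℕ) (s : State F Pr) : Prop where
  low : lowClauses High P ⊆ s.transfP
  sound : ∀ E ∈ s.transfP, SoundDefs P Δ E
  defined : ∀ E ∈ s.transfP, ∀ B ∈ E.body, High B.pred → Defined Δ B.pred
  covers : ∀ D ∈ s.defs, D ∉ s.inDefs → CoversDefs P High Δ wt s.transfP D
  phase : PhaseCorrect P High Δ wt s.phase

theorem CoversDefs.mono {T T' : Finset (Clause F Pr)} {C : Clause F Pr}
    (h : CoversDefs P High Δ wt T C) (hT : T ⊆ T') : CoversDefs P High Δ wt T' C := by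
  intro σ hσ
  obtain ⟨E, hE, h⟩ := h σ hσ
  exact ⟨E, hT hE, h⟩

theorem IsUnf.sound {D : Clause F Pr} {L R : Goal F Pr ℕ} {A : Atom F Pr ℕ}
    {S : Finset (Clause F Pr)} (h : IsUnf P D L A R S) (hb : D.body = L ++ A :: R)
    (hD : Sound P Δ D) : ∀ E ∈ S, Sound P Δ E := by
  intro E hE σ hσ
  obtain ⟨K, hK, hr⟩ := h.exists_isResolvent hE
  obtain ⟨σ', hh, hσ'⟩ := hr.sound hK hb hσ
  exact hh ▸ hD σ' hσ'

theorem CoversDefs.fold (hP : IsInput P High C₀) (hΔ : IsDefs P High C₀ Δ)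
    {T : Finset (Clause F Pr)} {C E D : Clause F Pr} {L Q R : Goal F Pr ℕ} {θ : ℕ → Term F ℕ}
    (h : CoversDefs P High Δ wt T C) (hD : D ∈ Δ) (hb : E.body.Perm (L ++ Q ++ R))
    (hf : CanFold E L Q R D θ) (hQ : ∀ B ∈ Q, Old P High B.pred)
    (hQd : ∀ B ∈ Q, ¬ Defined Δ B.pred) :
    CoversDefs P High Δ wt (T.erase E ∪ {folded E L R D θ}) C := by
  intro σ hσ
  obtain ⟨E', hE', σ', h₁, h₂, h₃⟩ := h σ hσ
  by_cases he : E' = E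
  · subst he
    obtain ⟨h₄, h₅⟩ := hf.complete (wt := wt) hP hΔ hD hb hQ hQd h₂
    exact ⟨folded E' L R D θ, by simp, σ', h₁, h₄, h₅.trans_lt h₃⟩
  · exact ⟨E', by simp [he, hE'], σ', h₁, h₂, h₃⟩

theorem IsInput.lowClauses_body (hP : IsInput P High C₀) {C : Clause F Pr}
    (hC : C ∈ lowClauses High P) : ∀ B ∈ C.body, ¬ High B.pred := by
  obtain ⟨hC, hl⟩ := mem_lowClauses.1 hC
  exact fun B hB hh => hP.dep _ _ hl hh (.of_mem hC hB)

theorem IsInput.correctInv_init (hP : IsInput P High C₀) (hΔ : IsDefs P High C₀ Δ) :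
    CorrectInv P High Δ wt (State.init P High C₀) := by
  refine ⟨subset_rfl, fun E hE σ hσ => ?_, fun E hE B hB hh => ?_,
    fun D hD hn => absurd hD hn, trivial⟩
  · have hE' := mem_lowClauses.1 hE
    refine (mem_defModel_iff_of_old hP hΔ (.inl hE'.2)).2
      (leastModel_isModel P E hE'.1 σ hσ.1 fun B hB => ?_)
    exact (mem_defModel_iff_of_old hP hΔ (.inl (hP.lowClauses_body hE B hB))).1 (hσ.2 B hB)
  · exact absurd hh (hP.lowClauses_body hE B hB)

/-- The weight decreases strictly at the first unfolding step, which establishes `Covers`; the later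
steps only preserve it. Halting is excluded because the removal of useless predicates may delete
clauses that the invariant retains. -/
theorem CorrectInv.step (hP : IsInput P High C₀) (hwt : IsWeight P High wt)
    (hΔ : IsDefs P High C₀ Δ) (hs : Step P High sel Gen s s') (hinv : DefsInv P High C₀ s)
    (hsub : s'.defs ⊆ Δ) (hh : s'.phase ≠ .halted) (h : CorrectInv P High Δ wt s) :
    CorrectInv P High Δ wt s' := by
  obtain ⟨hlow, hsound, hdef, hcov, hph⟩ := h
  cases hs with
  | @start X I Δ' S C L R A mem split high leftmost unf =>
    have hC : C ∈ Δ := hsub (hinv.sub mem)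
    refine ⟨hlow, hsound, hdef, hcov, fun D hD => ?_, fun σ hσ => ?_⟩
    · obtain ⟨E, hE, rfl⟩ := Finset.mem_image.1 hD
      exact unf.sound split (fun σ hσ => .inr ⟨C, hC, σ, rfl, hσ⟩) E hE
    · obtain ⟨E, hE, σ', h₁, h₂, -, h₃⟩ := unf.complete hwt hP.dep split hσ
      exact ⟨E, Finset.mem_image.2 ⟨_, Finset.mem_image_of_mem _ hE, rfl⟩, σ', h₁, h₂, h₃ high⟩
  | @unfold X I Δ' S C T D L R B mem split unfoldable unf =>
    refine ⟨hlow, hsound, hdef, hcov, fun D' hD' => ?_, hph.2.of_forall fun E hE σ hσ => ?_⟩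
    · rcases Finset.mem_union.1 hD' with hD' | hD'
      · exact hph.1 D' (Finset.mem_of_mem_erase hD')
      · obtain ⟨E, hE, rfl⟩ := Finset.mem_image.1 hD'
        exact unf.sound split (hph.1 D mem) E hE
    · obtain ⟨D', hD', rfl⟩ := Finset.mem_image.1 hE
      by_cases he : D' = D
      · subst he
        obtain ⟨E, hE, σ', h₁, h₂, h₃, -⟩ := unf.complete hwt hP.dep split hσ
        exact ⟨E, Finset.mem_image.2 ⟨_, Finset.mem_union_right _ (Finset.mem_image_of_mem _ hE),
          rfl⟩, σ', h₁, h₂, h₃⟩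
      · exact ⟨_, Finset.mem_image_of_mem _ (Finset.mem_union_left _
          (Finset.mem_erase.2 ⟨he, hD'⟩)), σ, rfl, hσ, le_rfl⟩
  | unfoldEnd none =>
    refine ⟨hlow, hsound, hdef, hcov, fun E hE => ?_, hph.2⟩
    obtain ⟨D, hD, rfl⟩ := Finset.mem_image.1 hE
    exact hph.1 D hD
  | replace repl =>
    obtain ⟨f, hf, rfl⟩ := repl
    refine ⟨hlow, hsound, hdef, hcov, fun E hE => ?_, hph.2.of_forall fun E hE σ hσ => ?_⟩
    · obtain ⟨D, hD, hE⟩ := Finset.mem_biUnion.1 hE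
      rcases hf D hD with h | h
      · rw [h, Finset.mem_singleton] at hE
        exact hE ▸ hph.1 D hD
      · exact h.sound (hph.1 D hD) E hE
    · rcases hf E hE with h | h
      · exact ⟨E, Finset.mem_biUnion.2 ⟨E, hE, by rw [h]; exact Finset.mem_singleton_self E⟩,
          σ, rfl, hσ, le_rfl⟩
      · obtain ⟨E', hE', h₁, h₂, h₃⟩ := h.complete (wt := wt) hσ
        exact ⟨E', Finset.mem_biUnion.2 ⟨E, hE, hE'⟩, σ, by rw [h₁], h₂, h₃.le⟩
  | remove mem unsat =>
    refine ⟨hlow, hsound, hdef, hcov, fun E hE => hph.1 E (Finset.mem_of_mem_erase hE),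
      hph.2.of_forall fun E hE σ hσ => ⟨E, Finset.mem_erase.2 ⟨?_, hE⟩, σ, rfl, hσ, le_rfl⟩⟩
    rintro rfl
    exact unsat ⟨σ, hσ.1⟩
  | removeEnd none =>
    refine ⟨hlow, hsound, hdef, hcov, fun E hE σ hσ => ?_,
      hph.2.coversDefs hP hwt hΔ hinv.phase.2⟩
    exact hph.1 E hE σ ((trueInDefs_iff_of_old hP hΔ (hinv.phase.2 E hE)).1 hσ)
  | fold mem toFold memD canFold =>
    have hQ := toFold.old (hinv.phase.2 _ mem)
    refine ⟨hlow, hsound, hdef, hcov, fun E hE => ?_, hph.2.fold hP hΔ (hsub memD) toFold.1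
      canFold hQ (toFold.not_defined hinv.defs.mem hΔ hQ)⟩
    rcases Finset.mem_union.1 hE with hE | hE
    · exact hph.1 E (Finset.mem_of_mem_erase hE)
    · rw [Finset.mem_singleton.1 hE]
      exact canFold.soundDefs hP hΔ (hsub memD) toFold.1 hQ (hph.1 _ mem)
  | @define X I Δ' T C E L Q R θ mem toFold none canFold =>
    have hQ := toFold.old (hinv.phase.2 _ mem)
    have hD : Gen E Q Δ' ∈ Δ := hsub (by simp)
    refine ⟨hlow, hsound, hdef, fun D hD hn => hcov D ?_ fun h => hn (Finset.mem_union_left _ h),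
      fun E hE => ?_, hph.2.fold hP hΔ hD toFold.1
      canFold hQ (toFold.not_defined hinv.defs.mem hΔ hQ)⟩
    · exact (Finset.mem_union.1 hD).resolve_right fun h => hn (Finset.mem_union_right _ h)
    · rcases Finset.mem_union.1 hE with hE | hE
      · exact hph.1 E (Finset.mem_of_mem_erase hE)
      · rw [Finset.mem_singleton.1 hE]
        exact canFold.soundDefs hP hΔ hD toFold.1 hQ (hph.1 _ mem)
  | @foldEnd X I Δ' T C none =>
    refine ⟨hlow.trans Finset.subset_union_left, fun E hE => ?_, fun E hE B hB hBh => ?_,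
      fun D hD hn => ?_, trivial⟩
    · exact (Finset.mem_union.1 hE).elim (hsound E) (hph.1 E)
    · rcases Finset.mem_union.1 hE with hE | hE
      · exact hdef E hE B hB hBh
      -- A high body atom with an undefined predicate could be folded as a conjunction by itself, so
      -- the folding phase would not have ended.
      · by_contra hnd
        obtain ⟨L, R, hLR⟩ := List.append_of_mem hB
        refine none E hE L [B] R ⟨by simp [hLR], ⟨B, by simp, hBh⟩, fun B' hB' D hD hp => ?_⟩
        rw [List.mem_singleton.1 hB'] at hp
        exact hnd ⟨D, hsub hD, hp⟩
    · by_cases hDC : D = C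
      · rw [hDC]
        exact hph.2.mono Finset.subset_union_right
      · exact (hcov D hD fun h => hn (Finset.mem_erase.2 ⟨hDC, h⟩)).mono
          Finset.subset_union_left
  | halt => exact absurd rfl hh

/-- `Δ` is fixed in advance and contains all definitions present in `s`. Thus the interpretation and
the weights do not change when a definition is introduced on the way. -/
theorem IsInput.correctInv (hP : IsInput P High C₀) (hGen : IsGenOp P High Gen)
    (hwt : IsWeight P High wt) (hΔ : IsDefs P High C₀ Δ)
    (hs : Reachable P High sel Gen (State.init P High C₀) s) (hsub : s.defs ⊆ Δ)
    (hh : s.phase ≠ .halted) : CorrectInv P High Δ wt s := by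
  induction hs with
  | refl => exact hP.correctInv_init hΔ
  | tail hr hstep ih =>
    refine CorrectInv.step hP hwt hΔ hstep (hP.defsInv hGen hr) hsub hh
      (ih (hstep.defs_subset.trans hsub) ?_)
    -- No step leaves a halted state, so the predecessor is not halted either.
    rintro h
    cases hstep <;> cases h

/-! ### From the invariants to the correctness of the output -/

theorem IsInput.low_mem_leastModel (hP : IsInput P High C₀) {X : Program F Pr}
    (hX : lowClauses High P ⊆ X) {A : Atom F Pr Empty} (hA : A ∈ leastModel P)
    (hl : ¬ High A.pred) : A ∈ leastModel X := by
  refine leastModel_subset (I := {A | ¬ High A.pred → A ∈ leastModel X})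
    (fun C hC σ hc hb hl => ?_) hA hl
  have hC' : C ∈ lowClauses High P := mem_lowClauses.2 ⟨hC, hl⟩
  exact leastModel_isModel X C (hX hC') σ hc
    fun B hB => hb B hB (hP.lowClauses_body hC' B hB)

/-- At the end of the main loop, `TransfP` derives each true instance of a definition. -/
theorem CorrectInv.head_mem_leastModel (hP : IsInput P High C₀) {X : Program F Pr}
    {p : Phase F Pr} (hΔ : IsDefs P High C₀ Δ) (h : CorrectInv P High Δ wt ⟨p, X, ∅, Δ⟩)
    (n : ℕ) : ∀ D ∈ Δ, ∀ σ, TrueIn P σ D.constr D.body → goalWt High wt σ D.body = n →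
      D.head.subst σ ∈ leastModel X := by
  induction n using Nat.strong_induction_on with
  | _ n ih =>
    rintro D hD σ hσ rfl
    obtain ⟨E, hE, σ', h₁, h₂, h₃⟩ := h.covers D hD (Finset.notMem_empty D) σ hσ
    rw [← h₁]
    refine leastModel_isModel X E hE σ' h₂.1 fun B hB => ?_
    -- A high body atom is defined, and its weight is attained by a true instance of a definition,
    -- so the induction hypothesis applies. A low one is derived by the retained clauses of P.
    by_cases hBh : High B.pred
    · obtain ⟨D', hD', τ, hh, hτ, hw⟩ := exists_goalWt_eq_defWt (High := High) (wt := wt)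
        (h₂.2 B hB) (h.defined E hE B hB hBh)
      rw [← hh]
      refine ih _ ?_ D' hD' τ hτ rfl
      rw [hw]
      exact (le_goalWt hB hBh).trans_lt h₃
    · exact hP.low_mem_leastModel h.low
        ((mem_defModel_iff_of_old hP hΔ (.inl hBh)).1 (h₂.2 B hB)) hBh

theorem Reachable.of_halted (hs : Reachable P High sel Gen (State.init P High C₀) s)
    (hh : s.phase = .halted) : ∃ X Δ,
      Reachable P High sel Gen (State.init P High C₀) ⟨.outer, X, ∅, Δ⟩ ∧
        s.transfP = removeUseless X := by
  rcases Relation.ReflTransGen.cases_tail hs with rfl | ⟨s₁, hr, hstep⟩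
  · cases hh
  · cases hstep <;> first | exact ⟨_, _, hr, rfl⟩ | cases hh

/-- Every output of the strategy has the same true instances of the head of `C₀` as `P`. -/
theorem IsInput.mem_leastModel_iff (hP : IsInput P High C₀) (hGen : IsGenOp P High Gen)
    {O : Program F Pr} (hO : IsOutput P High sel Gen (State.init P High C₀) O)
    {A : Atom F Pr Empty} (hA : A.pred = C₀.head.pred) :
    A ∈ leastModel P ↔ A ∈ leastModel O := by
  obtain ⟨s, hs, hh, rfl⟩ := hO
  obtain ⟨X, Δ, hr, hX⟩ := hs.of_halted hh
  obtain ⟨wt, hwt⟩ := exists_weight P High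
  have hΔ := (hP.defsInv hGen hr).defs
  have hinv := hP.correctInv hGen hwt hΔ hr subset_rfl (by simp)
  rw [hX, leastModel_removeUseless]
  constructor
  · intro h
    obtain ⟨σ, rfl, hσ, -⟩ := hP.exists_of_mem_leastModel hwt h hA.symm
    exact hinv.head_mem_leastModel hP hΔ _ C₀ hΔ.mem σ hσ rfl
  · intro h
    refine (mem_defModel_iff_of_old hP hΔ (hA ▸ .inr (occurs_head hP.mem))).1
      (leastModel_subset (I := defModel P Δ) (fun E hE σ hc hb => ?_) h)
    exact hinv.sound E hE σ ⟨hc, hb⟩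

end

section

variable {P : Program F Pr} {High : Pr → Prop} {C₀ : Clause F Pr} {sel : Selection F Pr}
  {Gen : GenOp F Pr} {s s' : State F Pr}

/-! ### Progress -/

theorem exists_leftmost {α : Type*} (p : α → Prop) {l : List α} (h : ∃ a ∈ l, p a) :
    ∃ L a R, l = L ++ a :: R ∧ p a ∧ ∀ b ∈ L, ¬ p b := by
  induction l with
  | nil => simp at h
  | cons a l ih =>
    by_cases ha : p a
    · exact ⟨[], a, l, rfl, ha, by simp⟩
    · obtain ⟨L, b, R, rfl, hb, hL⟩ := ih (by simpa [ha] using h)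
      exact ⟨a :: L, b, R, rfl, hb, by simpa [ha] using hL⟩

/-- No phase can get stuck: each definition has a high atom to unfold, a result of unfolding always
exists, replacement may do nothing, and the generalization operator supplies a clause whenever
`Defs` has none. -/
theorem DefsInv.exists_step (hGen : IsGenOp P High Gen) (h : DefsInv P High C₀ s)
    (hs : s.phase ≠ .halted) : ∃ s', Step P High sel Gen s s' := by
  obtain ⟨ph, X, I, Δ⟩ := s
  cases ph with
  | outer =>
    rcases I.eq_empty_or_nonempty with rfl | ⟨C, hC⟩
    · exact ⟨_, .halt⟩
    · obtain ⟨L, A, R, hb, hA, hL⟩ := exists_leftmost (fun B : Atom F Pr ℕ => High B.pred)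
        (h.defs.exists_high C (h.sub hC))
      obtain ⟨S, hS⟩ := exists_isUnf P C L A R
      exact ⟨_, .start hC hb hA hL hS⟩
  | unfolding C T =>
    by_cases hsel : ∃ D ∈ T, ∃ i < D.clause.body.length, sel D i
    · obtain ⟨D, hD, i, hi, hsi⟩ := hsel
      have hb : D.clause.body =
          D.clause.body.take i ++ D.clause.body[i] :: D.clause.body.drop (i + 1) := by simp
      obtain ⟨S, hS⟩ := exists_isUnf P D.clause (D.clause.body.take i) D.clause.body[i]
        (D.clause.body.drop (i + 1))
      exact ⟨_, .unfold hD hb (by simpa [hi.le] using hsi) hS⟩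
    · push Not at hsel
      exact ⟨_, .unfoldEnd hsel⟩
  | replacing C T =>
    exact ⟨_, .replace ⟨fun D => {D}, fun D _ => .inl rfl, rfl⟩⟩
  | removing C T =>
    by_cases hsat : ∃ E ∈ T, ¬ Constraint.Satisfiable E.constr
    · obtain ⟨E, hE, hsat⟩ := hsat
      exact ⟨_, .remove hE hsat⟩
    · push Not at hsat
      exact ⟨_, .removeEnd hsat⟩
  | folding C T =>
    by_cases hfold : ∃ E ∈ T, ∃ L Q R, ToFold High Δ E L Q R
    · obtain ⟨E, hE, L, Q, R, hfold⟩ := hfold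
      by_cases hD : ∃ D ∈ Δ, ∃ θ, CanFold E L Q R D θ
      · obtain ⟨D, hD, θ, hθ⟩ := hD
        exact ⟨_, .fold hE hfold hD hθ⟩
      · obtain ⟨-, -, θ, hθ⟩ := hGen E L Q R Δ hfold hD
        exact ⟨_, .define hE hfold hD hθ⟩
    · push Not at hfold
      exact ⟨_, .foldEnd hfold⟩
  | halted => exact absurd rfl hs

/-! ### Termination -/

/-- `E` is obtained from `D` by unfolding with respect to an unfoldable atom. -/
def SelUnfolds (P : Program F Pr) (sel : Selection F Pr) (E D : Derived F Pr) : Prop :=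
  ∃ i, sel D i ∧ UnfoldsTo P D i E

/-- An infinite descending chain from `E`, preceded by the clause from which the first unfolding
step produced `E`, would be one of the excluded sequences. -/
theorem FiniteUnfolding.acc (h : FiniteUnfolding P sel) {C : Clause F Pr} {i : ℕ}
    {E : Derived F Pr} (hE : UnfoldsTo P ⟨[], C⟩ i E) : Acc (SelUnfolds P sel) E := by
  by_contra hacc
  obtain ⟨f, rfl, hf⟩ := not_acc_iff_exists_descending_chain.1 hacc
  refine h ⟨fun n => n.casesOn ⟨[], C⟩ f, rfl, ⟨i, hE⟩, fun n hn => ?_⟩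
  obtain ⟨m, rfl⟩ : ∃ m, n = m + 1 := ⟨n - 1, by omega⟩
  exact hf m

/-- `SelUnfolds`, restricted to its well-founded part. -/
def AccUnfolds (P : Program F Pr) (sel : Selection F Pr) (E D : Derived F Pr) : Prop :=
  Acc (SelUnfolds P sel) D ∧ SelUnfolds P sel E D

instance isWellFounded_accUnfolds : IsWellFounded (Derived F Pr) (AccUnfolds P sel) := by
  refine ⟨⟨fun D => .intro D fun E hE => ?_⟩⟩
  have hacc := hE.1.inv hE.2
  clear hE
  induction hacc with
  | intro E _ ih => exact .intro E fun E' hE' => ih E' hE'.2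

/-- Since `TransfC` is a set, some results of unfolding may already be present. Only the genuinely
new ones are counted as replacing `a` in the multiset. -/
theorem cutExpand_union {α : Type*} [DecidableEq α] {r : α → α → Prop} {T S : Finset α} {a : α}
    (ha : a ∈ T) (hS : ∀ b ∈ S, r b a) :
    Relation.CutExpand r (T.erase a ∪ S).val T.val := by
  have hd : Disjoint (T.erase a) (S \ T.erase a) := Finset.disjoint_sdiff
  refine ⟨(S \ T.erase a).val, a, fun b hb => hS b (Finset.mem_sdiff.1 hb).1, ?_⟩
  have h₁ : (T.erase a ∪ S).val = (T.erase a).val + (S \ T.erase a).val := by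
    rw [← Finset.union_sdiff_self_eq_union, ← Finset.disjUnion_eq_union _ _ hd]
    rfl
  have h₂ : (T.erase a).val + {a} = T.val := by
    rw [Finset.erase_val, add_comm, Multiset.singleton_add, Multiset.cons_erase ha]
  rw [h₁, ← h₂, add_right_comm]

open Classical in
/-- The number of high body atoms whose predicates are not defined. -/
noncomputable def undefinedCount (High : Pr → Prop) (Δ : Finset (Clause F Pr))
    (G : Goal F Pr ℕ) : ℕ :=
  G.countP fun B => High B.pred ∧ ¬ Defined Δ B.pred

theorem undefinedCount_anti {Δ Δ' : Finset (Clause F Pr)} (h : Δ ⊆ Δ') (G : Goal F Pr ℕ) :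
    undefinedCount High Δ' G ≤ undefinedCount High Δ G := by
  refine List.countP_mono_left fun B _ hB => ?_
  simp only [decide_eq_true_eq] at hB ⊢
  exact ⟨hB.1, fun hd => hB.2 (hd.mono h)⟩

/-- `Q` contains a high atom, and none of its predicates is defined, so it contributes at least one.
The atom that replaces it is defined and contributes nothing, and more definitions only lower the
count elsewhere. -/
theorem undefinedCount_folded_lt {Δ Δ' : Finset (Clause F Pr)} {E D : Clause F Pr}
    {L Q R : Goal F Pr ℕ} {θ : ℕ → Term F ℕ} (h : ToFold High Δ E L Q R) (hs : Δ ⊆ Δ')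
    (hD : D ∈ Δ') :
    undefinedCount High Δ' (folded E L R D θ).body < undefinedCount High Δ E.body := by
  have hQ : 0 < undefinedCount High Δ Q := by
    obtain ⟨B, hB, hBh⟩ := h.2.1
    refine List.countP_pos_iff.2 ⟨B, hB, ?_⟩
    simp only [decide_eq_true_eq]
    exact ⟨hBh, fun ⟨D, hD, hp⟩ => h.2.2 B hB D hD hp⟩
  have hN : undefinedCount High Δ' [D.head.subst θ] = 0 := by
    refine List.countP_eq_zero.2 fun B hB => ?_
    rw [List.mem_singleton.1 hB]
    simp only [decide_eq_true_eq]
    exact fun hn => hn.2 ⟨D, hD, rfl⟩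
  have hE : undefinedCount High Δ E.body =
      undefinedCount High Δ L + undefinedCount High Δ Q + undefinedCount High Δ R := by
    simp only [undefinedCount, h.1.countP_eq, List.countP_append]
  have hF : undefinedCount High Δ' (folded E L R D θ).body = undefinedCount High Δ' L +
      undefinedCount High Δ' [D.head.subst θ] + undefinedCount High Δ' R := by
    have : (folded E L R D θ).body = L ++ [D.head.subst θ] ++ R := by simp [folded]
    simp only [undefinedCount, this, List.countP_append]
  have hL := undefinedCount_anti (High := High) hs L
  have hR := undefinedCount_anti (High := High) hs R
  omega

theorem sum_undefinedCount_lt {Δ Δ' T : Finset (Clause F Pr)} {E D : Clause F Pr}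
    {L Q R : Goal F Pr ℕ} {θ : ℕ → Term F ℕ} (h : ToFold High Δ E L Q R) (hs : Δ ⊆ Δ')
    (hD : D ∈ Δ') (hE : E ∈ T) :
    ∑ C ∈ T.erase E ∪ {folded E L R D θ}, undefinedCount High Δ' C.body <
      ∑ C ∈ T, undefinedCount High Δ C.body := by
  have h₁ := Finset.sum_union_inter (s₁ := T.erase E) (s₂ := {folded E L R D θ})
    (f := fun C : Clause F Pr => undefinedCount High Δ' C.body)
  rw [Finset.sum_singleton] at h₁
  have h₂ := Finset.sum_le_sum fun C (_ : C ∈ T.erase E) =>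
    undefinedCount_anti (High := High) hs C.body
  have h₃ := Finset.sum_erase_add T (fun C => undefinedCount High Δ C.body) hE
  have h₄ := undefinedCount_folded_lt (θ := θ) h hs hD
  omega

/-- The position of a control point in the body of the main loop, counted from its end. -/
def Phase.rank : Phase F Pr → ℕ
  | .outer => 5
  | .unfolding _ _ => 4
  | .replacing _ _ => 3
  | .removing _ _ => 2
  | .folding _ _ => 1
  | .halted => 0

/-- A measure of the work that is left to do at a control point. -/
noncomputable def Phase.work (P : Program F Pr) (High : Pr → Prop) (sel : Selection F Pr)
    (Δ : Finset (Clause F Pr)) : Phase F Pr → Ordinal.{max u v}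
  | .unfolding _ T => IsWellFounded.rank (Relation.CutExpand (AccUnfolds P sel)) T.val
  | .removing _ T => T.card
  | .folding _ T => (∑ E ∈ T, undefinedCount High Δ E.body : ℕ)
  | _ => 0

/-- The termination measure; `Δ` is the set of all definitions introduced during an execution. -/
noncomputable def State.work (P : Program F Pr) (High : Pr → Prop) (sel : Selection F Pr)
    (Δ : Finset (Clause F Pr)) (s : State F Pr) : ℕ ×ₗ ℕ ×ₗ Ordinal.{max u v} :=
  toLex ((Δ \ (s.defs \ s.inDefs)).card, toLex (s.phase.rank, s.phase.work P High sel s.defs))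

/-- Only finite sequences of unfolding steps start from the clauses that are being unfolded. -/
def PhaseAcc (P : Program F Pr) (sel : Selection F Pr) : Phase F Pr → Prop
  | .unfolding _ T => ∀ D ∈ T, Acc (SelUnfolds P sel) D
  | _ => True

theorem IsUnf.unfoldsTo {D : Derived F Pr} {L R : Goal F Pr ℕ} {A : Atom F Pr ℕ}
    {S : Finset (Clause F Pr)} (h : IsUnf P D.clause L A R S) (hb : D.clause.body = L ++ A :: R)
    {E : Derived F Pr} (hE : E ∈ S.image (D.extend L.length)) :
    UnfoldsTo P D L.length E := by
  obtain ⟨C, hC, rfl⟩ := Finset.mem_image.1 hE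
  obtain ⟨K, hK, hr⟩ := h.exists_isResolvent hC
  exact ⟨L, A, R, hb, rfl, K, hK, C, hr, rfl⟩

theorem PhaseAcc.step (hfin : FiniteUnfolding P sel) (hs : Step P High sel Gen s s')
    (h : PhaseAcc P sel s.phase) : PhaseAcc P sel s'.phase := by
  cases hs with
  | start mem split high leftmost unf => exact fun E hE => hfin.acc (unf.unfoldsTo split hE)
  | unfold mem split unfoldable unf =>
    intro E hE
    rcases Finset.mem_union.1 hE with hE | hE
    · exact h E (Finset.mem_of_mem_erase hE)
    · exact (h _ mem).inv ⟨_, unfoldable, unf.unfoldsTo split hE⟩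
  | _ => trivial

/-- The end of folding jumps back to the highest rank, but it moves `C` from the unprocessed
definitions to the processed ones. Every other step keeps the set of processed definitions, and
either advances the phase or reduces the work within it. -/
theorem Step.work_lt (hGen : IsGenOp P High Gen) {Δ : Finset (Clause F Pr)}
    (hs : Step P High sel Gen s s') (hinv : DefsInv P High C₀ s) (hacc : PhaseAcc P sel s.phase)
    (hsub : s'.defs ⊆ Δ) : s'.work P High sel Δ < s.work P High sel Δ := by
  have hrank : ∀ {s s' : State F Pr}, s'.defs \ s'.inDefs = s.defs \ s.inDefs →
      s'.phase.rank < s.phase.rank → s'.work P High sel Δ < s.work P High sel Δ := by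
    intro s s' h₁ h₂
    rw [State.work, State.work, h₁]
    exact Prod.Lex.toLex_lt_toLex.2 (.inr ⟨rfl, Prod.Lex.toLex_lt_toLex.2 (.inl h₂)⟩)
  have hwork : ∀ {s s' : State F Pr}, s'.defs \ s'.inDefs = s.defs \ s.inDefs →
      s'.phase.rank = s.phase.rank →
      s'.phase.work P High sel s'.defs < s.phase.work P High sel s.defs →
      s'.work P High sel Δ < s.work P High sel Δ := by
    intro s s' h₁ h₂ h₃
    rw [State.work, State.work, h₁]
    exact Prod.Lex.toLex_lt_toLex.2 (.inr ⟨rfl, Prod.Lex.toLex_lt_toLex.2 (.inr ⟨h₂, h₃⟩)⟩)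
  cases hs with
  | start => exact hrank rfl (by simp [Phase.rank])
  | unfold mem split unfoldable unf =>
    refine hwork rfl rfl (IsWellFounded.rank_lt_of_rel (cutExpand_union mem fun E hE => ?_))
    exact ⟨hacc _ mem, _, unfoldable, unf.unfoldsTo split hE⟩
  | unfoldEnd => exact hrank rfl (by simp [Phase.rank])
  | replace => exact hrank rfl (by simp [Phase.rank])
  | remove mem unsat =>
    refine hwork rfl rfl ?_
    simp only [Phase.work, Nat.cast_lt]
    exact Finset.card_erase_lt_of_mem mem
  | removeEnd => exact hrank rfl (by simp [Phase.rank])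
  | fold mem toFold memD canFold =>
    refine hwork rfl rfl ?_
    simp only [Phase.work, Nat.cast_lt]
    exact sum_undefinedCount_lt toFold subset_rfl memD mem
  | @define X I Δ' T C E L Q R θ mem toFold none canFold =>
    obtain ⟨-, hn, -⟩ := hGen E L Q R Δ' toFold none
    -- The new clause enters `Defs` and `InDefs` together. Being new, it does not make a processed
    -- definition unprocessed again, so the first component is unchanged.
    have hn' : Gen E Q Δ' ∉ Δ' := fun h => hn (occurs_head (Finset.mem_union_right _ h))
    refine hwork ?_ rfl ?_
    · ext D
      simp only [Finset.mem_sdiff, Finset.mem_union, Finset.mem_singleton]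
      constructor
      · tauto
      · rintro ⟨h₁, h₂⟩
        exact ⟨.inl h₁, fun h => h.elim h₂ fun h => hn' (h ▸ h₁)⟩
    · simp only [Phase.work, Nat.cast_lt]
      exact sum_undefinedCount_lt toFold Finset.subset_union_left (by simp) mem
  | @foldEnd X I Δ' T C none =>
    refine Prod.Lex.toLex_lt_toLex.2 (.inl (Finset.card_lt_card ?_))
    have hC : C ∈ I := hinv.phase.1
    refine Finset.ssubset_iff_subset_ne.2 ⟨?_, fun he => ?_⟩
    · exact Finset.sdiff_subset_sdiff subset_rfl
        (Finset.sdiff_subset_sdiff subset_rfl (Finset.erase_subset _ _))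
    · have hmem : C ∈ Δ \ (Δ' \ I) :=
        Finset.mem_sdiff.2 ⟨hsub (hinv.sub hC), fun h => (Finset.mem_sdiff.1 h).2 hC⟩
      rw [← he] at hmem
      exact (Finset.mem_sdiff.1 hmem).2
        (Finset.mem_sdiff.2 ⟨hinv.sub hC, Finset.notMem_erase _ _⟩)
  | halt => exact hrank rfl (by simp [Phase.rank])

theorem IsInput.terminates (hP : IsInput P High C₀) (hGen : IsGenOp P High Gen)
    (hfin : FiniteUnfolding P sel)
    (hdefs : FinitelyManyDefs P High sel Gen (State.init P High C₀)) :
    Terminates P High sel Gen (State.init P High C₀) := by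
  constructor
  · rintro ⟨r, hr⟩
    have hreach : ∀ n, Reachable P High sel Gen (State.init P High C₀) (r n) := by
      intro n
      induction n with
      | zero => rw [hr.1]; exact .refl
      | succ n ih => exact ih.tail (hr.2 n)
    have hacc : ∀ n, PhaseAcc P sel (r n).phase := by
      intro n
      induction n with
      | zero => rw [hr.1]; trivial
      | succ n ih => exact ih.step hfin (hr.2 n)
    have hsub : ∀ n, (r n).defs ⊆ (hdefs r hr).toFinset := fun n D hD =>
      (hdefs r hr).mem_toFinset.2 ⟨n, hD⟩
    obtain ⟨n, hn⟩ := WellFounded.not_rel_apply_succ (r := (· < ·))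
      fun n => (r n).work P High sel (hdefs r hr).toFinset
    exact hn ((hr.2 n).work_lt hGen (hP.defsInv hGen (hreach n)) (hacc n) (hsub (n + 1)))
  · intro s hs hstuck
    by_contra hh
    obtain ⟨s', hs'⟩ := (hP.defsInv hGen hs).exists_step (sel := sel) hGen hh
    exact hstuck s' hs'

end

end CLP

/-! ### Termination and correctness of the strategy -/

theorem theorem2 {F : Type*} {Pr : Type*} (P : CLP.Program F Pr) (High : Pr → Prop)
    (incorrect : Pr) (c : CLP.Constraint F ℕ) (G : CLP.Goal F Pr ℕ)
    -- the clause `incorrect :- c, G` is the only clause of `P` for `incorrect`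
    (hmem : (⟨⟨incorrect, []⟩, c, G⟩ : CLP.Clause F Pr) ∈ P)
    (hsingle : ∀ C ∈ P, C.head.pred = incorrect → C = ⟨⟨incorrect, []⟩, c, G⟩)
    -- `incorrect` is high, a high predicate occurs in `G`, no low predicate depends on a high one
    (hhigh : High incorrect)
    (hG : ∃ B ∈ G, High B.pred)
    (hdep : ∀ p q, ¬ High p → High q → ¬ CLP.DependsOn P p q)
    -- the auxiliary strategies
    (sel : CLP.Selection F Pr) (Gen : CLP.GenOp F Pr) (hGen : CLP.IsGenOp P High Gen) :
    (CLP.FiniteUnfolding P sel →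
      CLP.FinitelyManyDefs P High sel Gen
        (CLP.State.init P High ⟨⟨incorrect, []⟩, c, G⟩) →
      CLP.Terminates P High sel Gen (CLP.State.init P High ⟨⟨incorrect, []⟩, c, G⟩)) ∧
    (∀ TransfP : CLP.Program F Pr,
      CLP.IsOutput P High sel Gen (CLP.State.init P High ⟨⟨incorrect, []⟩, c, G⟩) TransfP →
      ((⟨incorrect, []⟩ : CLP.Atom F Pr Empty) ∈ CLP.leastModel P ↔
        (⟨incorrect, []⟩ : CLP.Atom F Pr Empty) ∈ CLP.leastModel TransfP)) := by
  have hP : CLP.IsInput P High ⟨⟨incorrect, []⟩, c, G⟩ := ⟨hmem, hsingle, hhigh, hG, hdep⟩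
  exact ⟨hP.terminates hGen, fun _ hO => hP.mem_leastModel_iff hGen hO rfl⟩
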